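/- Let $d\ge 1$, let $\Theta\subset\mathbb R^d$ be bounded, let $\Sigma$ be a symmetric positive definite $d\times d$ matrix with $\det\Sigma=1$ and extreme eigenvalues $\lambda_{\min}\le\lambda_{\max}$, and let $\lambda>0$. Let $f$ be the multivariate Laplace location kernel $$f(x|\theta)=\frac{2}{\lambda(2\pi)^{d/2}}\,\frac{K_{d/2-1}\!\left(\sqrt{2/\lambda}\,\|x-\theta\|_{\Sigma^{-1}}\right)}{\left(\sqrt{\lambda/2}\,\|x-\theta\|_{\Sigma^{-1}}\right)^{d/2-1}},\qquad \|y\|_{\Sigma^{-1}}=\sqrt{y^\top\Sigma^{-1}y},$$ where $K_\nu$ is the modified Bessel function of the second kind (at $x=\theta$ the kernel is given its limiting value in $(0,\infty]$). Write $\mathcal P(\Theta)$ for the set of probability measures on $\Theta$ and $p_G(x)=\int f(x|\theta)\,dG(\theta)$. Let $G_0$ be a probability measure on $\mathbb R^d$, let $f_0(\cdot|\theta_0)$, $\theta_0\in\operatorname{supp}G_0$, be a (measurable) family of probability densities on $\mathbb R^d$, and put $p_{G_0,f_0}(x)=\int f_0(x|\theta_0)\,dG_0(\theta_0)$. Let $G_*\in\mathcal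 P(\Theta)$ be a minimiser over $G\in\mathcal P(\Theta)$ of the Kullback--Leibler divergence $K(p_{G_0,f_0},p_G)$, and define the weighted Hellinger distance by $$\overline h^2(p_G,p_{G'})=\frac12\int\left(\sqrt{p_G(x)}-\sqrt{p_{G'}(x)}\right)^2\frac{p_{G_0,f_0}(x)}{p_{G_*}(x)}\,dx .$$ Assume condition (P.5) for some $\alpha\ge 1$ and $C_0,C_1>0$: the support of $G_0$ is bounded and, for every $R>0$, $$\sup_{\|x\|_2\le R,\ \theta\in\Theta,\ \theta_0\in\operatorname{supp}G_0}\frac{f(x|\theta)}{f_0(x|\theta_0)}\le C_1\exp(C_0R^\alpha).$$ Put $$\tau(\alpha)=\frac{\sqrt{2/(\lambda\lambda_{\max})}}{\left(\sqrt{2/(\lambda\lambda_{\min})}+\sqrt{2/(\lambda\lambda_{\max})}+C_0\right)^{1/\alpha}} .$$ Then there is $\epsilon_0\in(0,1)$, depending only on $d,\Theta,\lambda,\Sigma$, and for every $m$ with $0<m<4/(4+5d)$ there is a constant $C>0$, depending only on $d,\Theta,\Sigma,\lambda,G_0,C_1$ and $m$, such that for all $G,G'\in\mathcal P(\Theta)$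 with $\overline h=\overline h(p_G,p_{G'})\le\epsilon_0$, $$\left(\log\frac1{\overline h}\right)^{d/(2\alpha)}\exp\left(-\tau(\alpha)\left(\log\frac1{\overline h}\right)^{1/\alpha}\right)\ \ge\ C\,W_2^{2/m}(G,G'),$$ where $W_2$ is the Wasserstein distance of order $2$ for the Euclidean norm, and where the left-hand side is read as its limit $0$ when $\overline h=0$. -/

import Mathlib

open MeasureTheory Set Filter Topology
open scoped ENNReal

noncomputable section

/-- Largest eigenvalue of a symmetric real matrix. -/
def lambdaMax {d : ℕ} (S : Matrix (Fin d) (Fin d) ℝ) : ℝ := sSup (spectrum ℝ S)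

/-- Smallest eigenvalue of a symmetric real matrix. -/
def lambdaMin {d : ℕ} (S : Matrix (Fin d) (Fin d) ℝ) : ℝ := sInf (spectrum ℝ S)

/-- `√(yᵀ S⁻¹ y)`. -/
def mahalanobis {d : ℕ} (S : Matrix (Fin d) (Fin d) ℝ) (y : EuclideanSpace ℝ (Fin d)) : ℝ :=
  Real.sqrt (dotProduct y.ofLp (S⁻¹.mulVec y.ofLp))

/-- The modified Bessel function of the second kind `K_ν(z)`, for `z > 0`, by its integral
representation `∫₀^∞ exp (-z cosh t) cosh (ν t) dt`. -/
def besselK (ν z : ℝ) : ℝ :=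
  ∫ t in Ioi (0 : ℝ), Real.exp (-z * Real.cosh t) * Real.cosh (ν * t)

/-- The multivariate Laplace density with covariance shape `S` and scale `lam`, centred at the
origin and evaluated at `y ≠ 0`. -/
def laplaceFormula {d : ℕ} (S : Matrix (Fin d) (Fin d) ℝ) (lam : ℝ)
    (y : EuclideanSpace ℝ (Fin d)) : ℝ :=
  2 / (lam * (2 * Real.pi) ^ ((d : ℝ) / 2)) *
    (besselK ((d : ℝ) / 2 - 1) (Real.sqrt (2 / lam) * mahalanobis S y) /
      (Real.sqrt (lam / 2) * mahalanobis S y) ^ ((d : ℝ) / 2 - 1))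

/-- The Laplace location kernel `f(x|θ)`. The Bessel formula is indeterminate at `x = θ`; there the
kernel is given its limiting value, which is finite for `d = 1` and `∞` for `d ≥ 2`. -/
def laplaceKernel {d : ℕ} (S : Matrix (Fin d) (Fin d) ℝ) (lam : ℝ)
    (x θ : EuclideanSpace ℝ (Fin d)) : ℝ≥0∞ :=
  open Classical in
  if x = θ then limsup (fun y => ENNReal.ofReal (laplaceFormula S lam (y - θ))) (𝓝[≠] θ)
  else ENNReal.ofReal (laplaceFormula S lam (x - θ))

/-- The mixture density `x ↦ ∫ k(x|θ) dG(θ)` of a kernel `k` and a mixing measure `G`. -/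
def mixtureDensity {d : ℕ}
    (k : EuclideanSpace ℝ (Fin d) → EuclideanSpace ℝ (Fin d) → ℝ≥0∞)
    (G : Measure (EuclideanSpace ℝ (Fin d))) (x : EuclideanSpace ℝ (Fin d)) : ℝ≥0∞ :=
  ∫⁻ θ, k x θ ∂G

/-- The set of probability measures on `Θ`, seen as measures on the ambient space. -/
def mixingMeasures {d : ℕ} (Θ : Set (EuclideanSpace ℝ (Fin d))) :
    Set (Measure (EuclideanSpace ℝ (Fin d))) :=
  {G | IsProbabilityMeasure G ∧ G Θᶜ = 0}

/-- `k` is a family of probability densities (with respect to Lebesgue measure), indexed by the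
points of `T`. -/
def IsDensityKernel {d : ℕ}
    (k : EuclideanSpace ℝ (Fin d) → EuclideanSpace ℝ (Fin d) → ℝ≥0∞)
    (T : Set (EuclideanSpace ℝ (Fin d))) : Prop :=
  Measurable (Function.uncurry k) ∧ ∀ θ ∈ T, ∫⁻ x, k x θ = 1

/-- The support of `G₀` is bounded and, for every `R > 0`, the supremum of `f(x|θ) / f₀(x|θ₀)` over
`‖x‖ ≤ R`, `θ ∈ Θ`, `θ₀ ∈ supp G₀` is at most `C₁ exp (C₀ R ^ α)`. -/
def TailCondition {d : ℕ} (Θ : Set (EuclideanSpace ℝ (Fin d)))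
    (f f₀ : EuclideanSpace ℝ (Fin d) → EuclideanSpace ℝ (Fin d) → ℝ≥0∞)
    (G₀ : Measure (EuclideanSpace ℝ (Fin d))) (C₀ C₁ α : ℝ) : Prop :=
  Bornology.IsBounded G₀.support ∧
    ∀ R : ℝ, 0 < R →
      (⨆ (x : EuclideanSpace ℝ (Fin d)) (_ : ‖x‖ ≤ R) (θ ∈ Θ) (θ₀ ∈ G₀.support),
        f x θ / f₀ x θ₀) ≤ ENNReal.ofReal (C₁ * Real.exp (C₀ * R ^ α))

/-- `Gs` minimises `G ↦ K(p₀, p_G)` over the probability measures on `Θ`, where `K` is the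
Kullback-Leibler divergence and `p_G` is the mixture density of the kernel `f`. -/
def IsKLMinimizer {d : ℕ} (Θ : Set (EuclideanSpace ℝ (Fin d)))
    (f : EuclideanSpace ℝ (Fin d) → EuclideanSpace ℝ (Fin d) → ℝ≥0∞)
    (p₀ : EuclideanSpace ℝ (Fin d) → ℝ≥0∞)
    (Gs : Measure (EuclideanSpace ℝ (Fin d))) : Prop :=
  Gs ∈ mixingMeasures Θ ∧
    ∀ G ∈ mixingMeasures Θ,
      InformationTheory.klDiv (volume.withDensity p₀) (volume.withDensity (mixtureDensity f Gs)) ≤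
        InformationTheory.klDiv (volume.withDensity p₀) (volume.withDensity (mixtureDensity f G))

/-- The weighted Hellinger distance between densities `p` and `q`, with weight `p₀ / ps`:
the square root of `(1/2) ∫ (√p - √q)² p₀ / ps`. -/
def weightedHellinger {d : ℕ} (p₀ ps p q : EuclideanSpace ℝ (Fin d) → ℝ≥0∞) : ℝ≥0∞ :=
  (2⁻¹ * ∫⁻ x, ENNReal.ofReal ((Real.sqrt (p x).toReal - Real.sqrt (q x).toReal) ^ 2) *
    (p₀ x / ps x)) ^ (1 / 2 : ℝ)

/-- The Wasserstein distance of order `r`: the infimum over couplings `π` of `G` and `G'` of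
`(∫ ‖θ - θ'‖ ^ r dπ) ^ (1 / r)`. -/
def wasserstein {d : ℕ} (r : ℝ) (G G' : Measure (EuclideanSpace ℝ (Fin d))) : ℝ≥0∞ :=
  ⨅ (π : Measure (EuclideanSpace ℝ (Fin d) × EuclideanSpace ℝ (Fin d)))
    (_ : π.map Prod.fst = G ∧ π.map Prod.snd = G'),
      (∫⁻ z, ENNReal.ofReal (‖z.1 - z.2‖ ^ r) ∂π) ^ (1 / r)

/-- The exponent `τ(α)`. -/
def tauExponent {d : ℕ} (S : Matrix (Fin d) (Fin d) ℝ) (lam C₀ α : ℝ) : ℝ :=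
  Real.sqrt (2 / (lam * lambdaMax S)) /
    (Real.sqrt (2 / (lam * lambdaMin S)) + Real.sqrt (2 / (lam * lambdaMax S)) + C₀) ^ (1 / α)

/-- The quantity `(log (1/h)) ^ (d/(2α)) * exp (-τ(α) (log (1/h)) ^ (1/α))`, for `0 ≤ h < 1`.
At `h = 0` this expression evaluates to `0` (when `d ≥ 1`), which is its limit as `h → 0+`. -/
def laplaceRate {d : ℕ} (S : Matrix (Fin d) (Fin d) ℝ) (lam C₀ α h : ℝ) : ℝ :=
  Real.log (1 / h) ^ ((d : ℝ) / (2 * α)) *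
    Real.exp (-tauExponent S lam C₀ α * Real.log (1 / h) ^ (1 / α))

/-- The value at `h = 0` of the rate is its limit there. -/
theorem laplaceRate_zero {d : ℕ} (hd : 1 ≤ d) (S : Matrix (Fin d) (Fin d) ℝ)
    (lam C₀ α : ℝ) (hα : 1 ≤ α) : laplaceRate S lam C₀ α 0 = 0 := by
  have h : (d : ℝ) / (2 * α) ≠ 0 := by
    have : (0 : ℝ) < d := by exact_mod_cast hd
    positivity
  simp [laplaceRate, Real.zero_rpow h]

end

/-!
The Laplace density is the exponential mixture `f = ∫₀^∞ e^{-t} g_{lam t} dt` of the Gaussian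
densities `g_v` with covariance `v S`: the integral defining the Bessel function turns into this one
under `t = c e^u` (`ofReal_laplaceFormula`). Since the `g_v` form a convolution semigroup, splitting
the integral at `t = η` gives the resolvent identity

  `f = (1 - e^{-η}) K_η + e^{-η} g_{lam η} * f`,

with `K_η` a probability density of second moment `O(η)` (`laplaceDensity_resolvent`). Hence
`K_η * (G - G')` is, up to the factor `2 / (1 - e^{-η})`, bounded in `L¹` by the total variation `V`
between `p_G` and `p_G'`; no Fourier analysis is needed.

For any probability kernel `K`, an overlap coupling of `K * G` and `K * G'` lifts to an explicit
coupling of `G` and `G'` (`wasserstein_sq_le_of_smoothing`), so `W₂² ≤ O(η) + O(V / η)`. With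
`η = √V` this reads `W₂² ≤ O(√V)`, that is `W₂^{2/m} ≤ O(V^{1/(2m)})`.

It remains to bound `V` by the weighted Hellinger distance `h`. The tail condition gives
`p₀ / p_* ≥ exp (-C₀ R^α) / C₁` on the ball of radius `R`, so there Cauchy-Schwarz bounds the
variation by `√C₁ exp (C₀ R^α / 2) h`. Off the ball the exponential moments of `f` up to
`a = √(2 / (lam λ_max))` give the tail `O(exp (-κ a R))` for any `κ < 1`. The choice
`R = (log (1/h) / (a + b + C₀))^{1/α}`, with `b = √(2 / (lam λ_min))`, makes `exp (-a R)` the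
exponential factor of the rate, and `V = O(exp (-κ a R))`. As `m < 4 / (4 + 5 d) ≤ 4 / 9`, the
exponent `1 / (2m)` exceeds `9 / 8`, so `κ = 8 / 9` suffices to reach `W₂^{2/m} ≤ O(exp (-a R))`.
-/

noncomputable section

variable {d : ℕ}

local notation "E" => EuclideanSpace ℝ (Fin d)

/-! ### Lifting an overlap coupling through a smoothing kernel -/

theorem ENNReal.div_max_add_tsub_div_max {a b : ℝ≥0∞} (ha : a ≠ 0) (ha' : a ≠ ∞) (hb' : b ≠ ∞) :
    b / max a b + (a - b) / max a b = 1 := by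
  rw [← ENNReal.add_div, add_tsub_eq_max, max_comm]
  exact ENNReal.div_self (by simp [ha]) (by simp [ha', hb'])

theorem ENNReal.mul_tsub_div_max {a b : ℝ≥0∞} (ha : a ≠ 0) (ha' : a ≠ ∞) :
    a * ((a - b) / max a b) = a - b := by
  rcases le_total a b with h | h
  · simp [tsub_eq_zero_of_le h]
  · rw [max_eq_left h, ENNReal.mul_div_cancel ha ha']

section Coupling

variable {K : EuclideanSpace ℝ (Fin d) → EuclideanSpace ℝ (Fin d) → ℝ≥0∞}
  {G G' : Measure (EuclideanSpace ℝ (Fin d))}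

theorem measurable_mixtureDensity [SFinite G] (hK : Measurable (Function.uncurry K)) :
    Measurable (mixtureDensity K G) := hK.lintegral_prod_right'

theorem lintegral_mixtureDensity [IsProbabilityMeasure G] (hK : Measurable (Function.uncurry K))
    (h1 : ∀ θ, ∫⁻ z, K z θ = 1) : ∫⁻ z, mixtureDensity K G z = 1 := by
  unfold mixtureDensity
  rw [lintegral_lintegral_swap hK.aemeasurable]
  simp [h1]

/-- If one smooths `G` and `G'` by the same probability kernel `K`, an overlap coupling of the
smoothed densities `a = ∫ K dG`, `b = ∫ K dG'` lifts to a coupling of `G` and `G'`. This is its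
density with respect to `G ⊗ G'`. -/
def overlapDensity (K : E → E → ℝ≥0∞) (G G' : Measure E) (p : E × E) : ℝ≥0∞ :=
  ∫⁻ z, K z p.1 * K z p.2 / max (mixtureDensity K G z) (mixtureDensity K G' z)

/-- The part of `G`, as a density with respect to `G`, left over by the overlap coupling. -/
def excessDensity (K : E → E → ℝ≥0∞) (G G' : Measure E) (θ : E) : ℝ≥0∞ :=
  ∫⁻ z, K z θ * ((mixtureDensity K G z - mixtureDensity K G' z) /
    max (mixtureDensity K G z) (mixtureDensity K G' z))

theorem measurable_overlapDensity [SFinite G] [SFinite G'] (hK : Measurable (Function.uncurry K)) :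
    Measurable (overlapDensity K G G') := by
  have ha := measurable_mixtureDensity (G := G) hK
  have hb := measurable_mixtureDensity (G := G') hK
  refine Measurable.lintegral_prod_right' (f := fun q : (E × E) × E =>
    K q.2 q.1.1 * K q.2 q.1.2 / max (mixtureDensity K G q.2) (mixtureDensity K G' q.2)) ?_
  have h1 : Measurable fun q : (E × E) × E => K q.2 q.1.1 :=
    hK.comp (measurable_snd.prodMk (measurable_fst.comp measurable_fst))
  have h2 : Measurable fun q : (E × E) × E => K q.2 q.1.2 :=
    hK.comp (measurable_snd.prodMk (measurable_snd.comp measurable_fst))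
  exact (h1.mul h2).div ((ha.comp measurable_snd).max (hb.comp measurable_snd))

theorem measurable_excessDensity [SFinite G] [SFinite G'] (hK : Measurable (Function.uncurry K)) :
    Measurable (excessDensity K G G') := by
  have ha := measurable_mixtureDensity (G := G) hK
  have hb := measurable_mixtureDensity (G := G') hK
  refine Measurable.lintegral_prod_right' (f := fun q : E × E => K q.2 q.1 *
    ((mixtureDensity K G q.2 - mixtureDensity K G' q.2) /
      max (mixtureDensity K G q.2) (mixtureDensity K G' q.2))) ?_
  exact (hK.comp measurable_swap).mul (((ha.sub hb).div (ha.max hb)).comp measurable_snd)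

theorem overlapDensity_swap (p : E × E) :
    overlapDensity K G G' p.swap = overlapDensity K G' G p := by
  simp only [overlapDensity, Prod.fst_swap, Prod.snd_swap]
  refine lintegral_congr fun z => ?_
  rw [mul_comm, max_comm]

variable [IsProbabilityMeasure G] [IsProbabilityMeasure G']

theorem mixtureDensity_ne_zero (hK : Measurable (Function.uncurry K)) (h0 : ∀ z θ, K z θ ≠ 0)
    (z : E) : mixtureDensity K G z ≠ 0 := by
  intro h
  have hKz : Measurable fun θ => K z θ := hK.comp measurable_prodMk_left
  rw [mixtureDensity, lintegral_eq_zero_iff hKz] at h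
  obtain ⟨θ, hθ⟩ := h.exists
  exact h0 z θ hθ

theorem mixtureDensity_ae_ne_top (hK : Measurable (Function.uncurry K))
    (h1 : ∀ θ, ∫⁻ z, K z θ = 1) : ∀ᵐ z, mixtureDensity K G z ≠ ∞ := by
  filter_upwards [ae_lt_top (measurable_mixtureDensity hK)
    (by rw [lintegral_mixtureDensity (G := G) hK h1]; simp)] with z hz using hz.ne

/-- The overlap coupling together with the excess has the right marginal. -/
theorem lintegral_overlapDensity_add_excessDensity (hK : Measurable (Function.uncurry K))
    (h0 : ∀ z θ, K z θ ≠ 0) (h1 : ∀ θ, ∫⁻ z, K z θ = 1) (θ : E) :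
    ∫⁻ θ', overlapDensity K G G' (θ, θ') ∂G' + excessDensity K G G' θ = 1 := by
  have ha := measurable_mixtureDensity (G := G) hK
  have hb := measurable_mixtureDensity (G := G') hK
  have hKθ : Measurable fun z => K z θ := hK.comp measurable_prodMk_right
  have e1 : ∫⁻ θ', overlapDensity K G G' (θ, θ') ∂G' =
      ∫⁻ z, K z θ * (mixtureDensity K G' z /
        max (mixtureDensity K G z) (mixtureDensity K G' z)) := by
    unfold overlapDensity
    rw [lintegral_lintegral_swap]
    · refine lintegral_congr fun z => ?_
      simp only [div_eq_mul_inv, mul_assoc]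
      have hKz : Measurable fun θ' => K z θ' := hK.comp measurable_prodMk_left
      rw [lintegral_const_mul _ (hKz.mul_const _), lintegral_mul_const _ hKz]
      rfl
    · refine Measurable.aemeasurable ?_
      exact ((hKθ.comp measurable_snd).mul (hK.comp measurable_swap)).div
        ((ha.max hb).comp measurable_snd)
  have hm : Measurable fun z => K z θ * (mixtureDensity K G' z /
      max (mixtureDensity K G z) (mixtureDensity K G' z)) := hKθ.mul (hb.div (ha.max hb))
  rw [e1, excessDensity, ← lintegral_add_left hm, ← h1 θ]
  refine lintegral_congr_ae ?_
  filter_upwards [mixtureDensity_ae_ne_top (G := G) hK h1,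
    mixtureDensity_ae_ne_top (G := G') hK h1] with z hz hz'
  rw [← mul_add, ENNReal.div_max_add_tsub_div_max (mixtureDensity_ne_zero hK h0 z) hz hz', mul_one]

/-- The excess has mass `∫ (a - b)⁺`. -/
theorem lintegral_excessDensity (hK : Measurable (Function.uncurry K))
    (h0 : ∀ z θ, K z θ ≠ 0) (h1 : ∀ θ, ∫⁻ z, K z θ = 1) :
    ∫⁻ θ, excessDensity K G G' θ ∂G = ∫⁻ z, (mixtureDensity K G z - mixtureDensity K G' z) := by
  have ha := measurable_mixtureDensity (G := G) hK
  have hb := measurable_mixtureDensity (G := G') hK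
  unfold excessDensity
  rw [lintegral_lintegral_swap]
  · refine lintegral_congr_ae ?_
    filter_upwards [mixtureDensity_ae_ne_top (G := G) hK h1] with z hz
    have hKz : Measurable fun θ' => K z θ' := hK.comp measurable_prodMk_left
    rw [lintegral_mul_const _ hKz]
    exact ENNReal.mul_tsub_div_max (mixtureDensity_ne_zero hK h0 z) hz
  · exact ((hK.comp measurable_swap).mul
      (((ha.sub hb).div (ha.max hb)).comp measurable_snd)).aemeasurable

theorem lintegral_tsub_mixtureDensity_comm (hK : Measurable (Function.uncurry K))
    (h1 : ∀ θ, ∫⁻ z, K z θ = 1) :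
    ∫⁻ z, (mixtureDensity K G z - mixtureDensity K G' z) =
      ∫⁻ z, (mixtureDensity K G' z - mixtureDensity K G z) := by
  have ha := measurable_mixtureDensity (G := G) hK
  have hb := measurable_mixtureDensity (G := G') hK
  have h : (1 : ℝ≥0∞) + ∫⁻ z, (mixtureDensity K G' z - mixtureDensity K G z) =
      1 + ∫⁻ z, (mixtureDensity K G z - mixtureDensity K G' z) := by
    nth_rw 1 [← lintegral_mixtureDensity (G := G) hK h1]
    rw [← lintegral_mixtureDensity (G := G') hK h1, ← lintegral_add_left ha,
      ← lintegral_add_left hb]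
    refine lintegral_congr fun z => ?_
    rw [add_tsub_eq_max, add_tsub_eq_max, max_comm]
  exact ((ENNReal.add_right_inj (by simp)).1 h).symm

/-- The cost of moving `θ` to the smoothing variable `z` along the overlap coupling, as a function
of the coupled pair. -/
def overlapMoment (K : E → E → ℝ≥0∞) (G G' : Measure E) (p : E × E) : ℝ≥0∞ :=
  ∫⁻ z, ENNReal.ofReal (‖z - p.1‖ ^ 2) *
    (K z p.1 * K z p.2 / max (mixtureDensity K G z) (mixtureDensity K G' z))

theorem measurable_overlapMoment (hK : Measurable (Function.uncurry K)) :
    Measurable (overlapMoment K G G') := by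
  have ha := measurable_mixtureDensity (G := G) hK
  have hb := measurable_mixtureDensity (G := G') hK
  refine Measurable.lintegral_prod_right' (f := fun q : (E × E) × E =>
    ENNReal.ofReal (‖q.2 - q.1.1‖ ^ 2) * (K q.2 q.1.1 * K q.2 q.1.2 /
      max (mixtureDensity K G q.2) (mixtureDensity K G' q.2))) ?_
  have h1 : Measurable fun q : (E × E) × E => K q.2 q.1.1 :=
    hK.comp (measurable_snd.prodMk (measurable_fst.comp measurable_fst))
  have h2 : Measurable fun q : (E × E) × E => K q.2 q.1.2 :=
    hK.comp (measurable_snd.prodMk (measurable_snd.comp measurable_fst))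
  have h3 : Measurable fun q : (E × E) × E => ENNReal.ofReal (‖q.2 - q.1.1‖ ^ 2) := by fun_prop
  exact h3.mul ((h1.mul h2).div ((ha.comp measurable_snd).max (hb.comp measurable_snd)))

theorem lintegral_overlapMoment_le (hK : Measurable (Function.uncurry K)) {s : ℝ≥0∞}
    (hs : ∀ θ, ∫⁻ z, ENNReal.ofReal (‖z - θ‖ ^ 2) * K z θ ≤ s) :
    ∫⁻ p, overlapMoment K G G' p ∂(G.prod G') ≤ s := by
  have ha := measurable_mixtureDensity (G := G) hK
  have hb := measurable_mixtureDensity (G := G') hK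
  rw [lintegral_prod _ (measurable_overlapMoment hK).aemeasurable]
  calc _ ≤ ∫⁻ θ, s ∂G := ?_
    _ = s := by simp
  refine lintegral_mono fun θ => ?_
  have hKθ : Measurable fun z => K z θ := hK.comp measurable_prodMk_right
  have hcθ : Measurable fun z : E => ENNReal.ofReal (‖z - θ‖ ^ 2) := by fun_prop
  unfold overlapMoment
  rw [lintegral_lintegral_swap]
  · refine (lintegral_mono fun z => ?_).trans (hs θ)
    have hKz : Measurable fun θ' => K z θ' := hK.comp measurable_prodMk_left
    simp only [div_eq_mul_inv, mul_assoc]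
    rw [lintegral_const_mul _ ((hKz.mul_const _).const_mul _),
      lintegral_const_mul _ (hKz.mul_const _), lintegral_mul_const _ hKz, ← div_eq_mul_inv]
    refine mul_le_mul_right (mul_le_of_le_one_right' (ENNReal.div_le_of_le_mul ?_)) _
    rw [one_mul]; exact le_max_right _ _
  · exact ((hcθ.comp measurable_snd).mul
      (((hKθ.comp measurable_snd).mul (hK.comp measurable_swap)).div
        ((ha.max hb).comp measurable_snd))).aemeasurable

/-- Moving `θ` to `z` and `z` to `θ'` bounds the transport cost of the overlap coupling by the
second moment of the kernel. -/
theorem lintegral_sq_mul_overlapDensity_le (hK : Measurable (Function.uncurry K)) {s : ℝ≥0∞}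
    (hs : ∀ θ, ∫⁻ z, ENNReal.ofReal (‖z - θ‖ ^ 2) * K z θ ≤ s) :
    ∫⁻ p, ENNReal.ofReal (‖p.1 - p.2‖ ^ 2) * overlapDensity K G G' p ∂(G.prod G') ≤ 4 * s := by
  have ha := measurable_mixtureDensity (G := G) hK
  have hb := measurable_mixtureDensity (G := G') hK
  have hpt : ∀ p : E × E, ENNReal.ofReal (‖p.1 - p.2‖ ^ 2) * overlapDensity K G G' p ≤
      2 * (overlapMoment K G G' p + overlapMoment K G' G p.swap) := by
    intro p
    have hKp1 : Measurable fun z => K z p.1 := hK.comp measurable_prodMk_right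
    have hKp2 : Measurable fun z => K z p.2 := hK.comp measurable_prodMk_right
    have hKp : Measurable fun z => K z p.1 * K z p.2 / max (mixtureDensity K G z)
        (mixtureDensity K G' z) := (hKp1.mul hKp2).div (ha.max hb)
    have hcp : Measurable fun z : E => ENNReal.ofReal (‖z - p.1‖ ^ 2) *
        (K z p.1 * K z p.2 / max (mixtureDensity K G z) (mixtureDensity K G' z)) :=
      Measurable.mul (by fun_prop) hKp
    simp only [overlapDensity, overlapMoment, Prod.fst_swap, Prod.snd_swap]
    rw [← lintegral_const_mul _ hKp, ← lintegral_add_left hcp,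
      ← lintegral_const_mul' _ _ (by simp)]
    refine lintegral_mono fun z => ?_
    rw [mul_comm (K z p.2), max_comm (mixtureDensity K G' z), ← add_mul, ← mul_assoc]
    refine mul_le_mul_left ?_ _
    have h2 : (2 : ℝ≥0∞) = ENNReal.ofReal (2 : ℝ) := by simp
    rw [← ENNReal.ofReal_add (by positivity) (by positivity)]
    refine le_of_le_of_eq ?_ (congrArg (· * _) h2.symm)
    rw [← ENNReal.ofReal_mul (by simp)]
    refine ENNReal.ofReal_le_ofReal ?_
    have h : ‖p.1 - p.2‖ ≤ ‖z - p.1‖ + ‖z - p.2‖ := by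
      have := norm_sub_le (z - p.2) (z - p.1)
      rw [show z - p.2 - (z - p.1) = p.1 - p.2 by abel] at this
      linarith
    nlinarith [sq_nonneg (‖z - p.1‖ - ‖z - p.2‖), norm_nonneg (p.1 - p.2)]
  refine (lintegral_mono hpt).trans ?_
  rw [lintegral_const_mul' _ _ (by simp), lintegral_add_left (measurable_overlapMoment hK)]
  have h2 : ∫⁻ p : E × E, overlapMoment K G' G p.swap ∂(G.prod G') ≤ s := by
    rw [lintegral_prod_swap]
    exact lintegral_overlapMoment_le hK hs
  calc _ ≤ 2 * (s + s) := by
        gcongr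
        exact lintegral_overlapMoment_le hK hs
    _ = 4 * s := by ring

/-- **Smoothing bound for the Wasserstein distance.** Smoothing two probability measures by a
kernel of second moment at most `s` controls their distance by the `L¹` distance of the smoothed
densities. -/
theorem wasserstein_sq_le_of_smoothing (hK : Measurable (Function.uncurry K))
    (h0 : ∀ z θ, K z θ ≠ 0) (h1 : ∀ θ, ∫⁻ z, K z θ = 1) {s : ℝ≥0∞}
    (hs : ∀ θ, ∫⁻ z, ENNReal.ofReal (‖z - θ‖ ^ 2) * K z θ ≤ s) {D : ℝ}
    (hD : ∀ᵐ θ ∂G, ∀ᵐ θ' ∂G', ‖θ - θ'‖ ≤ D) :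
    wasserstein 2 G G' ^ 2 ≤ 4 * s + ENNReal.ofReal (D ^ 2) *
      ∫⁻ z, (mixtureDensity K G z - mixtureDensity K G' z) := by
  have ha := measurable_mixtureDensity (G := G) hK
  have hb := measurable_mixtureDensity (G := G') hK
  set M := ∫⁻ z, (mixtureDensity K G z - mixtureDensity K G' z) with hM
  have hM1 : M ≤ 1 := by
    rw [hM, ← lintegral_mixtureDensity (G := G) hK h1]
    exact lintegral_mono fun z => tsub_le_self
  have hMt : M ≠ ∞ := ne_top_of_le_ne_top ENNReal.one_ne_top hM1
  set r := excessDensity K G G' with hr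
  set r' := excessDensity K G' G with hr'
  have hrm : Measurable r := measurable_excessDensity hK
  have hrm' : Measurable r' := measurable_excessDensity hK
  have hrM : ∫⁻ θ, r θ ∂G = M := lintegral_excessDensity hK h0 h1
  have hrM' : ∫⁻ θ, r' θ ∂G' = M := by
    rw [hr', lintegral_excessDensity hK h0 h1, hM]; exact lintegral_tsub_mixtureDensity_comm hK h1
  have hwm : Measurable (overlapDensity K G G') := measurable_overlapDensity hK
  -- the coupling: overlap, plus independent coupling of the two excesses
  set ρ : E × E → ℝ≥0∞ := fun p => overlapDensity K G G' p + r p.1 * r' p.2 / M with hρ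
  have hρ2m : Measurable fun p : E × E => r p.1 * r' p.2 / M :=
    ((hrm.comp measurable_fst).mul (hrm'.comp measurable_snd)).div_const _
  have hρm : Measurable ρ := hwm.add hρ2m
  -- if `M = 0` the division below gives `0`, but then the excess vanishes almost everywhere
  have key : ∀ {r₀ : E → ℝ≥0∞} {μ : Measure E}, Measurable r₀ → ∫⁻ θ, r₀ θ ∂μ = M →
      ∀ᵐ θ ∂μ, r₀ θ * M / M = r₀ θ := by
    intro r₀ μ hm hi
    by_cases hM0 : M = 0
    · rw [hM0, lintegral_eq_zero_iff hm] at hi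
      filter_upwards [hi] with θ hθ
      simp [hθ]
    · exact Eventually.of_forall fun θ => ENNReal.mul_div_cancel_right hM0 hMt
  have marg1 : ∀ᵐ θ ∂G, ∫⁻ θ', ρ (θ, θ') ∂G' = 1 := by
    filter_upwards [key hrm hrM] with θ hθ
    have e : ∫⁻ θ', r θ * r' θ' / M ∂G' = r θ := by
      simp only [div_eq_mul_inv]
      rw [lintegral_mul_const _ (hrm'.const_mul _), lintegral_const_mul _ hrm', hrM',
        ← div_eq_mul_inv, hθ]
    have hw : Measurable fun θ' => overlapDensity K G G' (θ, θ') :=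
      hwm.comp measurable_prodMk_left
    simp only [hρ]
    rw [lintegral_add_left hw, e]
    exact lintegral_overlapDensity_add_excessDensity hK h0 h1 θ
  have marg2 : ∀ᵐ θ' ∂G', ∫⁻ θ, ρ (θ, θ') ∂G = 1 := by
    filter_upwards [key hrm' hrM'] with θ' hθ
    have e : ∫⁻ θ, r θ * r' θ' / M ∂G = r' θ' := by
      simp only [div_eq_mul_inv]
      rw [lintegral_mul_const _ (hrm.mul_const _), lintegral_mul_const _ hrm, hrM,
        ← div_eq_mul_inv, mul_comm, hθ]
    have hw : Measurable fun θ => overlapDensity K G G' (θ, θ') :=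
      hwm.comp measurable_prodMk_right
    simp only [hρ]
    rw [lintegral_add_left hw, e]
    rw [← lintegral_overlapDensity_add_excessDensity (G := G') (G' := G) hK h0 h1 θ']
    congr 1
    exact lintegral_congr fun θ => overlapDensity_swap (θ', θ)
  set π : Measure (E × E) := (G.prod G').withDensity ρ with hπ
  have hπ1 : π.map Prod.fst = G := by
    ext A hA
    rw [Measure.map_apply measurable_fst hA, hπ, withDensity_apply _ (measurable_fst hA),
      ← lintegral_indicator (measurable_fst hA), lintegral_prod _
        (hρm.indicator (measurable_fst hA)).aemeasurable, ← lintegral_indicator_one hA]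
    refine lintegral_congr_ae ?_
    filter_upwards [marg1] with θ hθ
    by_cases h : θ ∈ A
    · simp [h, indicator, hθ]
    · simp [h, indicator]
  have hπ2 : π.map Prod.snd = G' := by
    ext A hA
    rw [Measure.map_apply measurable_snd hA, hπ, withDensity_apply _ (measurable_snd hA),
      ← lintegral_indicator (measurable_snd hA), lintegral_prod_symm _
        (hρm.indicator (measurable_snd hA)).aemeasurable, ← lintegral_indicator_one hA]
    refine lintegral_congr_ae ?_
    filter_upwards [marg2] with θ hθ
    by_cases h : θ ∈ A
    · simp [h, indicator, hθ]
    · simp [h, indicator]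
  have hcm : Measurable fun p : E × E => ENNReal.ofReal (‖p.1 - p.2‖ ^ 2) := by fun_prop
  have cost1 := lintegral_sq_mul_overlapDensity_le (G := G) (G' := G') hK hs
  have cost2 : ∫⁻ p, ENNReal.ofReal (‖p.1 - p.2‖ ^ 2) * (r p.1 * r' p.2 / M) ∂(G.prod G') ≤
      ENNReal.ofReal (D ^ 2) * M := by
    calc _ ≤ ∫⁻ p, ENNReal.ofReal (D ^ 2) * (r p.1 * r' p.2 / M) ∂(G.prod G') := by
          have hm : Measurable fun p : E × E =>
              ENNReal.ofReal (‖p.1 - p.2‖ ^ 2) * (r p.1 * r' p.2 / M) := hcm.mul hρ2m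
          rw [lintegral_prod _ hm.aemeasurable,
            lintegral_prod _ (hρ2m.const_mul _).aemeasurable]
          refine lintegral_mono_ae ?_
          filter_upwards [hD] with θ hθ
          refine lintegral_mono_ae ?_
          filter_upwards [hθ] with θ' h
          gcongr
      _ = ENNReal.ofReal (D ^ 2) * (M * M / M) := by
          rw [lintegral_const_mul _ hρ2m]
          congr 1
          rw [lintegral_prod _ hρ2m.aemeasurable]
          simp only [div_eq_mul_inv]
          have : ∀ θ, ∫⁻ θ', r θ * r' θ' * M⁻¹ ∂G' = r θ * (M * M⁻¹) := fun θ => by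
            rw [lintegral_mul_const _ (hrm'.const_mul _), lintegral_const_mul _ hrm', hrM',
              mul_assoc]
          simp only [this]
          rw [lintegral_mul_const _ hrm, hrM, mul_assoc]
      _ ≤ ENNReal.ofReal (D ^ 2) * M := by
          gcongr
          rw [mul_div_assoc]
          exact mul_le_of_le_one_right' ENNReal.div_self_le_one
  have hle : wasserstein 2 G G' ≤
      (∫⁻ z, ENNReal.ofReal (‖z.1 - z.2‖ ^ (2 : ℝ)) ∂π) ^ (1 / (2 : ℝ)) :=
    iInf₂_le π ⟨hπ1, hπ2⟩
  calc wasserstein 2 G G' ^ 2 ≤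
      ((∫⁻ z, ENNReal.ofReal (‖z.1 - z.2‖ ^ (2 : ℝ)) ∂π) ^ (1 / (2 : ℝ))) ^ 2 := by gcongr
    _ = ∫⁻ z, ENNReal.ofReal (‖z.1 - z.2‖ ^ 2) ∂π := by
        rw [← ENNReal.rpow_natCast, ← ENNReal.rpow_mul]
        norm_num
    _ = ∫⁻ p, ENNReal.ofReal (‖p.1 - p.2‖ ^ 2) * overlapDensity K G G' p ∂(G.prod G') +
        ∫⁻ p, ENNReal.ofReal (‖p.1 - p.2‖ ^ 2) * (r p.1 * r' p.2 / M) ∂(G.prod G') := by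
        have hm : Measurable fun p : E × E =>
            ENNReal.ofReal (‖p.1 - p.2‖ ^ 2) * overlapDensity K G G' p := hcm.mul hwm
        rw [hπ, lintegral_withDensity_eq_lintegral_mul _ hρm hcm, ← lintegral_add_left hm]
        refine lintegral_congr fun p => ?_
        simp only [hρ, Pi.mul_apply]
        ring
    _ ≤ _ := add_le_add cost1 cost2

end Coupling

/-! ### The Mahalanobis norm -/

open scoped MatrixOrder in
/-- A positive semidefinite real matrix is a Gram matrix. -/
theorem Matrix.PosSemidef.exists_eq_transpose_mul_self {A : Matrix (Fin d) (Fin d) ℝ}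
    (hA : A.PosSemidef) : ∃ B : Matrix (Fin d) (Fin d) ℝ, A = B.transpose * B := by
  obtain ⟨B, hB⟩ := CStarAlgebra.nonneg_iff_eq_star_mul_self.1 hA.nonneg
  exact ⟨B, by rw [hB, Matrix.star_eq_conjTranspose, Matrix.conjTranspose_eq_transpose_of_trivial]⟩

open scoped MatrixOrder in
theorem dotProduct_mulVec_le_lambdaMax {S : Matrix (Fin d) (Fin d) ℝ}
    (hS : S.PosDef) (v : Fin d → ℝ) :
    dotProduct v (S.mulVec v) ≤ lambdaMax S * dotProduct v v := by
  have hfin : (spectrum ℝ S).Finite := Matrix.finite_real_spectrum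
  have h : S ≤ algebraMap ℝ (Matrix (Fin d) (Fin d) ℝ) (lambdaMax S) :=
    le_algebraMap_of_spectrum_le (fun x hx => le_csSup hfin.bddAbove hx)
      hS.isHermitian
  have h2 := (Matrix.le_iff.1 h).dotProduct_mulVec_nonneg v
  simp [Matrix.sub_mulVec, Algebra.algebraMap_eq_smul_one, Matrix.smul_mulVec] at h2
  linarith

theorem lambdaMax_pos (hd : 1 ≤ d) {S : Matrix (Fin d) (Fin d) ℝ} (hS : S.PosDef) :
    0 < lambdaMax S := by
  have hv : (Pi.single ⟨0, hd⟩ 1 : Fin d → ℝ) ≠ 0 := by simp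
  have h1 := hS.dotProduct_mulVec_pos hv
  have h2 := dotProduct_mulVec_le_lambdaMax hS (Pi.single ⟨0, hd⟩ 1 : Fin d → ℝ)
  simp at h1 h2
  linarith

/-- The Mahalanobis norm is the Euclidean norm after a volume preserving linear change of
variables. -/
theorem exists_linearMap_mahalanobis {S : Matrix (Fin d) (Fin d) ℝ} (hS : S.PosDef)
    (hdet : S.det = 1) :
    ∃ B : EuclideanSpace ℝ (Fin d) →ₗ[ℝ] EuclideanSpace ℝ (Fin d),
      |LinearMap.det B| = 1 ∧ ∀ y, mahalanobis S y = ‖B y‖ := by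
  obtain ⟨B, hB⟩ := hS.inv.posSemidef.exists_eq_transpose_mul_self
  refine ⟨Matrix.toLpLin 2 2 B, ?_, fun y => ?_⟩
  · have h1 : (S⁻¹).det = 1 := by
      rw [Matrix.det_nonsing_inv, hdet]; simp
    rw [hB, Matrix.det_mul, Matrix.det_transpose] at h1
    have h2 : LinearMap.det (Matrix.toLpLin 2 2 B) = B.det := by
      rw [Matrix.toLpLin_eq_toLin]
      exact LinearMap.det_toLin _ B
    rw [h2]
    nlinarith [abs_mul_abs_self B.det, abs_nonneg B.det]
  · rw [mahalanobis, EuclideanSpace.norm_eq, hB]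
    congr 1
    rw [← Matrix.mulVec_mulVec, Matrix.dotProduct_mulVec, Matrix.vecMul_transpose]
    simp [dotProduct, Matrix.toLpLin_apply, sq]

theorem norm_le_mahalanobis (hd : 1 ≤ d) {S : Matrix (Fin d) (Fin d) ℝ} (hS : S.PosDef)
    (y : EuclideanSpace ℝ (Fin d)) :
    ‖y‖ ≤ Real.sqrt (lambdaMax S) * mahalanobis S y := by
  have hl := lambdaMax_pos hd hS
  have hdetu : IsUnit S.det := isUnit_iff_ne_zero.2 hS.det_pos.ne'
  set w := S⁻¹.mulVec y.ofLp with hw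
  have hSw : S.mulVec w = y.ofLp := by
    rw [hw, Matrix.mulVec_mulVec, Matrix.mul_nonsing_inv _ hdetu, Matrix.one_mulVec]
  set q := dotProduct y.ofLp w
  have hyy : dotProduct y.ofLp y.ofLp = ‖y‖ ^ 2 := by
    rw [EuclideanSpace.real_norm_sq_eq]; simp [dotProduct, sq]
  have hyS := dotProduct_mulVec_le_lambdaMax hS y.ofLp
  have hsym : dotProduct w (S.mulVec y.ofLp) = ‖y‖ ^ 2 := by
    rw [Matrix.dotProduct_mulVec, ← Matrix.mulVec_transpose,
      show S.transpose = S from by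
        have := hS.isHermitian.eq; rwa [Matrix.conjTranspose_eq_transpose_of_trivial] at this,
      hSw, hyy]
  -- positivity of the form `S` at `y - λ w`, i.e. the Cauchy-Schwarz inequality for `S`
  have hpos := hS.posSemidef.dotProduct_mulVec_nonneg (y.ofLp - lambdaMax S • w)
  simp only [star_trivial, Matrix.mulVec_sub, Matrix.mulVec_smul, hSw, sub_dotProduct,
    dotProduct_sub, smul_dotProduct, dotProduct_smul, hsym, hyy, smul_eq_mul,
    dotProduct_comm w y.ofLp] at hpos
  rw [hyy] at hyS
  have hq : ‖y‖ ^ 2 ≤ lambdaMax S * q := by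
    have : lambdaMax S * ‖y‖ ^ 2 ≤ lambdaMax S * (lambdaMax S * q) := by
      nlinarith
    exact le_of_mul_le_mul_left this hl
  rw [mahalanobis, ← Real.sqrt_mul hl.le]
  exact Real.le_sqrt_of_sq_le hq

/-! ### The Gaussian semigroup -/

theorem mahalanobis_nonneg (S : Matrix (Fin d) (Fin d) ℝ) (y : E) : 0 ≤ mahalanobis S y :=
  Real.sqrt_nonneg _

theorem continuous_mahalanobis (S : Matrix (Fin d) (Fin d) ℝ) : Continuous (mahalanobis S) := by
  unfold mahalanobis
  refine Real.continuous_sqrt.comp ?_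
  refine Continuous.dotProduct (by fun_prop) ?_
  exact Continuous.matrix_mulVec continuous_const (by fun_prop)

theorem lintegral_comp_linearMap_of_abs_det_eq_one {B : E →ₗ[ℝ] E}
    (hB : |LinearMap.det B| = 1) {f : E → ℝ≥0∞} (hf : Measurable f) :
    ∫⁻ y, f (B y) = ∫⁻ y, f y := by
  have h0 : LinearMap.det B ≠ 0 := by
    intro h; simp [h] at hB
  have hm := Measure.map_linearMap_addHaar_eq_smul_addHaar (volume : Measure E) h0
  rw [abs_inv, hB, inv_one, ENNReal.ofReal_one, one_smul] at hm
  have hBc : Measurable B := (LinearMap.continuous_of_finiteDimensional B).measurable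
  rw [← lintegral_map hf hBc, hm]

theorem lintegral_exp_neg_mul_mahalanobis_sq {S : Matrix (Fin d) (Fin d) ℝ} (hS : S.PosDef)
    (hdet : S.det = 1) {c : ℝ} (hc : 0 < c) :
    ∫⁻ y : E, ENNReal.ofReal (Real.exp (-c * mahalanobis S y ^ 2)) =
      ENNReal.ofReal ((Real.pi / c) ^ ((d : ℝ) / 2)) := by
  obtain ⟨B, hB, hρ⟩ := exists_linearMap_mahalanobis hS hdet
  simp only [hρ]
  rw [lintegral_comp_linearMap_of_abs_det_eq_one hB
    (f := fun z => ENNReal.ofReal (Real.exp (-c * ‖z‖ ^ 2))) (by fun_prop)]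
  have h := GaussianFourier.integral_rexp_neg_mul_sq_norm (V := E) hc
  rw [finrank_euclideanSpace_fin] at h
  rw [← h, ofReal_integral_eq_lintegral_ofReal]
  · by_contra hi
    rw [integral_undef hi] at h
    have : 0 < (Real.pi / c) ^ ((d : ℝ) / 2) := by positivity
    linarith
  · exact Eventually.of_forall fun _ => (Real.exp_pos _).le

/-- The centred Gaussian density with covariance matrix `v • S`, where `det S = 1`. -/
def gaussDensity (S : Matrix (Fin d) (Fin d) ℝ) (v : ℝ) (y : E) : ℝ≥0∞ :=
  ENNReal.ofReal ((2 * Real.pi * v) ^ (-((d : ℝ) / 2)) *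
    Real.exp (-(mahalanobis S y ^ 2 / (2 * v))))

theorem measurable_gaussDensity_uncurry (S : Matrix (Fin d) (Fin d) ℝ) :
    Measurable fun p : ℝ × E => gaussDensity S p.1 p.2 := by
  have := (continuous_mahalanobis S).measurable
  unfold gaussDensity
  fun_prop

theorem measurable_gaussDensity (S : Matrix (Fin d) (Fin d) ℝ) (v : ℝ) :
    Measurable (gaussDensity S v) :=
  (measurable_gaussDensity_uncurry S).comp measurable_prodMk_left

theorem gaussDensity_ne_zero (S : Matrix (Fin d) (Fin d) ℝ) {v : ℝ} (hv : 0 < v) (y : E) :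
    gaussDensity S v y ≠ 0 := by
  have : 0 < (2 * Real.pi * v) ^ (-((d : ℝ) / 2)) *
      Real.exp (-(mahalanobis S y ^ 2 / (2 * v))) := by
    positivity
  simpa [gaussDensity] using this

theorem gaussDensity_lt_top (S : Matrix (Fin d) (Fin d) ℝ) (v : ℝ) (y : E) :
    gaussDensity S v y < ∞ := ENNReal.ofReal_lt_top

section

variable {S : Matrix (Fin d) (Fin d) ℝ} (hS : S.PosDef) (hdet : S.det = 1)
include hS hdet

theorem lintegral_gaussDensity_rescaled {v : ℝ} (hv : 0 < v) {κ : ℝ} (hκ : 0 < κ) :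
    ∫⁻ y : E, ENNReal.ofReal ((2 * Real.pi * v) ^ (-((d : ℝ) / 2)) *
      Real.exp (-(κ * (mahalanobis S y ^ 2 / (2 * v))))) =
      ENNReal.ofReal (κ ^ (-((d : ℝ) / 2))) := by
  have h : ∀ y : E, -(κ * (mahalanobis S y ^ 2 / (2 * v))) =
      -(κ / (2 * v)) * mahalanobis S y ^ 2 := fun y => by ring
  simp only [h]
  have hp : 0 ≤ (2 * Real.pi * v) ^ (-((d : ℝ) / 2)) := by positivity
  simp only [ENNReal.ofReal_mul hp]
  rw [lintegral_const_mul' _ _ ENNReal.ofReal_ne_top,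
    lintegral_exp_neg_mul_mahalanobis_sq hS hdet (by positivity), ← ENNReal.ofReal_mul hp]
  congr 1
  have hw : 0 < 2 * Real.pi * v := by positivity
  rw [show Real.pi / (κ / (2 * v)) = κ⁻¹ * (2 * Real.pi * v) by field_simp,
    Real.mul_rpow (inv_nonneg.2 hκ.le) hw.le, Real.rpow_neg hw.le, Real.rpow_neg hκ.le,
    Real.inv_rpow hκ.le, mul_left_comm, inv_mul_cancel₀ (Real.rpow_pos_of_pos hw _).ne', mul_one]

theorem lintegral_gaussDensity {v : ℝ} (hv : 0 < v) : ∫⁻ y : E, gaussDensity S v y = 1 := by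
  simpa [gaussDensity] using lintegral_gaussDensity_rescaled hS hdet hv one_pos

/-- Completing the square in the Mahalanobis norm. -/
theorem mahalanobis_complete_square {s t : ℝ} (hs : 0 < s) (ht : 0 < t) (x y : E) :
    mahalanobis S (x - y) ^ 2 / (2 * s) + mahalanobis S y ^ 2 / (2 * t) =
      mahalanobis S x ^ 2 / (2 * (s + t)) +
        mahalanobis S (y - (t / (s + t)) • x) ^ 2 / (2 * (s * t / (s + t))) := by
  obtain ⟨B, hB, hρ⟩ := exists_linearMap_mahalanobis hS hdet
  simp only [hρ, map_sub, map_smul]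
  rw [norm_sub_sq_real, norm_sub_sq_real, norm_smul, inner_smul_right, real_inner_comm,
    Real.norm_of_nonneg (by positivity)]
  field_simp
  ring

/-- The Gaussian densities form a convolution semigroup. -/
theorem lintegral_gaussDensity_mul_gaussDensity {s t : ℝ} (hs : 0 < s) (ht : 0 < t) (x : E) :
    ∫⁻ y : E, gaussDensity S s (x - y) * gaussDensity S t y = gaussDensity S (s + t) x := by
  have hst : 0 < s * t / (s + t) := by positivity
  have hpt : ∀ y : E, gaussDensity S s (x - y) * gaussDensity S t y =
      gaussDensity S (s + t) x *
        gaussDensity S (s * t / (s + t)) (y - (t / (s + t)) • x) := by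
    intro y
    unfold gaussDensity
    rw [← ENNReal.ofReal_mul (by positivity), ← ENNReal.ofReal_mul (by positivity)]
    congr 1
    have e := mahalanobis_complete_square hS hdet hs ht x y
    rw [mul_mul_mul_comm, mul_mul_mul_comm ((2 * Real.pi * (s + t)) ^ _), ← Real.exp_add,
      ← Real.exp_add, ← neg_add, ← neg_add, e,
      ← Real.mul_rpow (by positivity) (by positivity),
      ← Real.mul_rpow (by positivity) (by positivity)]
    congr 2
    field_simp
  simp only [hpt]
  rw [lintegral_const_mul' _ _ (gaussDensity_lt_top S _ x).ne,
    lintegral_sub_right_eq_self (μ := volume) (fun y => gaussDensity S (s * t / (s + t)) y),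
    lintegral_gaussDensity hS hdet hst, mul_one]

/-- The second moment grows linearly in the variance parameter. -/
theorem lintegral_sq_mul_gaussDensity_le (hd : 1 ≤ d) {v : ℝ} (hv : 0 < v) :
    ∫⁻ y : E, ENNReal.ofReal (‖y‖ ^ 2) * gaussDensity S v y ≤
      ENNReal.ofReal (4 * lambdaMax S * v * (1 / 2) ^ (-((d : ℝ) / 2))) := by
  have hl := lambdaMax_pos hd hS
  rw [ENNReal.ofReal_mul (by positivity),
    ← lintegral_gaussDensity_rescaled hS hdet hv (one_half_pos (α := ℝ)),
    ← lintegral_const_mul' _ _ ENNReal.ofReal_ne_top]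
  refine lintegral_mono fun y => ?_
  unfold gaussDensity
  rw [← ENNReal.ofReal_mul (by positivity), ← ENNReal.ofReal_mul (by positivity)]
  refine ENNReal.ofReal_le_ofReal ?_
  have hy : ‖y‖ ^ 2 ≤ lambdaMax S * mahalanobis S y ^ 2 := by
    have h := pow_le_pow_left₀ (norm_nonneg y) (norm_le_mahalanobis hd hS y) 2
    rwa [mul_pow, Real.sq_sqrt hl.le] at h
  set u := mahalanobis S y ^ 2 / (2 * v) with hu
  have hu2 : mahalanobis S y ^ 2 = 2 * v * u := by rw [hu]; field_simp
  -- `u ≤ 2 exp (u / 2)` trades the quadratic factor for half of the exponent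
  have he : u * Real.exp (-u) ≤ 2 * Real.exp (-(1 / 2 * u)) := by
    have h1 : u / 2 ≤ Real.exp (u / 2) := by linarith [Real.add_one_le_exp (u / 2)]
    have h2 : Real.exp (-(1 / 2 * u)) = Real.exp (u / 2) * Real.exp (-u) := by
      rw [← Real.exp_add]; ring_nf
    rw [h2]
    nlinarith [Real.exp_pos (-u)]
  have hp : 0 < (2 * Real.pi * v) ^ (-((d : ℝ) / 2)) := by positivity
  calc ‖y‖ ^ 2 * ((2 * Real.pi * v) ^ (-((d : ℝ) / 2)) * Real.exp (-u))
      ≤ (lambdaMax S * (2 * v * u)) * ((2 * Real.pi * v) ^ (-((d : ℝ) / 2)) * Real.exp (-u)) := by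
        rw [hu2] at hy; gcongr
    _ = 2 * lambdaMax S * v * (2 * Real.pi * v) ^ (-((d : ℝ) / 2)) * (u * Real.exp (-u)) := by ring
    _ ≤ 2 * lambdaMax S * v * (2 * Real.pi * v) ^ (-((d : ℝ) / 2)) *
        (2 * Real.exp (-(1 / 2 * u))) := by gcongr
    _ = _ := by ring

/-- Exponential moments of the Gaussian with covariance `lam * t • S`. The exponent is a fraction
`8/9` of the critical one for the Laplace law, which makes the growth rate in `t` less than `1`. -/
theorem lintegral_exp_mul_gaussDensity_le (hd : 1 ≤ d) {lam t : ℝ} (hlam : 0 < lam) (ht : 0 < t) :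
    ∫⁻ y : E, ENNReal.ofReal (Real.exp (8 / 9 * Real.sqrt (2 / (lam * lambdaMax S)) * ‖y‖)) *
        gaussDensity S (lam * t) y ≤
      ENNReal.ofReal (Real.exp (640 / 729 * t) * (1 / 10) ^ (-((d : ℝ) / 2))) := by
  have hl := lambdaMax_pos hd hS
  have hv : 0 < lam * t := by positivity
  rw [ENNReal.ofReal_mul (by positivity),
    ← lintegral_gaussDensity_rescaled hS hdet hv (show (0 : ℝ) < 1 / 10 by norm_num),
    ← lintegral_const_mul' _ _ ENNReal.ofReal_ne_top]
  refine lintegral_mono fun y => ?_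
  unfold gaussDensity
  rw [← ENNReal.ofReal_mul (by positivity), ← ENNReal.ofReal_mul (by positivity)]
  refine ENNReal.ofReal_le_ofReal ?_
  rw [mul_left_comm, mul_left_comm (Real.exp _), ← Real.exp_add, ← Real.exp_add]
  refine mul_le_mul_of_nonneg_left (Real.exp_le_exp.2 ?_) (by positivity)
  have hy := norm_le_mahalanobis hd hS y
  set ρ := mahalanobis S y
  have h1 : Real.sqrt (2 / (lam * lambdaMax S)) * ‖y‖ ≤ Real.sqrt (2 / lam) * ρ := by
    calc Real.sqrt (2 / (lam * lambdaMax S)) * ‖y‖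
        ≤ Real.sqrt (2 / (lam * lambdaMax S)) * (Real.sqrt (lambdaMax S) * ρ) := by gcongr
      _ = Real.sqrt (2 / lam) * ρ := by
        rw [← mul_assoc, ← Real.sqrt_mul (by positivity)]
        congr 2
        field_simp
  set a := Real.sqrt (2 / lam) * ρ with ha
  have h2 : ρ ^ 2 / (2 * (lam * t)) = a ^ 2 / (4 * t) := by
    rw [ha, mul_pow, Real.sq_sqrt (by positivity)]
    field_simp
    ring
  rw [h2]
  -- nine tenths of the Gaussian exponent absorb the linear term, at the price `(640 / 729) t`
  have h3 : 8 / 9 * a ≤ 9 / 10 * (a ^ 2 / (4 * t)) + 640 / 729 * t := by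
    have : 9 / 10 * (a ^ 2 / (4 * t)) + 640 / 729 * t - 8 / 9 * a =
        9 / (40 * t) * (a - 160 / 81 * t) ^ 2 := by
      field_simp
      ring
    have h4 : 0 ≤ 9 / (40 * t) * (a - 160 / 81 * t) ^ 2 := by positivity
    linarith
  nlinarith

end

/-! ### The Bessel formula as an exponential mixture -/

theorem integrable_exp_neg_mul_cosh_mul_cosh (ν : ℝ) {z : ℝ} (hz : 0 < z) :
    Integrable fun t => Real.exp (-z * Real.cosh t) * Real.cosh (ν * t) := by
  have hg : Integrable fun t : ℝ => Real.exp (2 * ν ^ 2 / z) * Real.exp (-(z / 8) * t ^ 2) :=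
    (integrable_exp_neg_mul_sq (by positivity)).const_mul _
  refine hg.mono' (by fun_prop) (Eventually.of_forall fun t => ?_)
  rw [Real.norm_of_nonneg (mul_nonneg (Real.exp_pos _).le (Real.cosh_pos _).le), ← Real.exp_add]
  have h1 : Real.cosh (ν * t) ≤ Real.exp |ν * t| := by
    rw [← Real.cosh_abs, Real.cosh_eq]
    have : Real.exp (-|ν * t|) ≤ Real.exp |ν * t| :=
      Real.exp_le_exp.2 (by linarith [abs_nonneg (ν * t)])
    linarith
  have h2 : t ^ 2 / 4 ≤ Real.cosh t := by
    have := Real.quadratic_le_exp_of_nonneg (abs_nonneg t)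
    rw [sq_abs] at this
    rw [← Real.cosh_abs, Real.cosh_eq]
    linarith [Real.exp_pos (-|t|), abs_nonneg t]
  calc Real.exp (-z * Real.cosh t) * Real.cosh (ν * t)
      ≤ Real.exp (-z * Real.cosh t) * Real.exp |ν * t| := by gcongr
    _ = Real.exp (-z * Real.cosh t + |ν * t|) := by rw [Real.exp_add]
    _ ≤ _ := by
      refine Real.exp_le_exp.2 ?_
      rw [abs_mul]
      have h3 : |ν| * |t| ≤ 2 * ν ^ 2 / z + z / 8 * t ^ 2 := by
        have : 2 * ν ^ 2 / z + z / 8 * t ^ 2 - |ν| * |t| = (2 / z) * (|ν| - z / 4 * |t|) ^ 2 := by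
          rw [← sq_abs ν, ← sq_abs t]
          field_simp
          ring
        have h4 : 0 ≤ (2 / z) * (|ν| - z / 4 * |t|) ^ 2 := by positivity
        linarith
      nlinarith

/-- The Bessel function as an integral over the whole line. -/
theorem two_mul_besselK (ν : ℝ) {z : ℝ} (hz : 0 < z) :
    ENNReal.ofReal (2 * besselK ν z) =
      ∫⁻ u : ℝ, ENNReal.ofReal (Real.exp (-z * Real.cosh u) * Real.exp (-ν * u)) := by
  set A : ℝ → ℝ≥0∞ := fun u =>
    ENNReal.ofReal (Real.exp (-z * Real.cosh u) * Real.exp (-ν * u)) with hA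
  have hAm : Measurable A := by fun_prop
  have h1 : 2 * besselK ν z = ∫ u : ℝ, Real.exp (-z * Real.cosh u) * Real.cosh (ν * u) := by
    rw [besselK, ← integral_comp_abs
      (f := fun t => Real.exp (-z * Real.cosh t) * Real.cosh (ν * t))]
    refine integral_congr_ae (Eventually.of_forall fun u => ?_)
    simp only [Real.cosh_abs]
    rw [← Real.cosh_abs (ν * |u|), abs_mul, abs_abs, ← abs_mul, Real.cosh_abs]
  rw [h1, ofReal_integral_eq_lintegral_ofReal (integrable_exp_neg_mul_cosh_mul_cosh ν hz)
    (Eventually.of_forall fun u => mul_nonneg (Real.exp_pos _).le (Real.cosh_pos _).le)]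
  have h2 : ∀ u, ENNReal.ofReal (Real.exp (-z * Real.cosh u) * Real.cosh (ν * u)) =
      2⁻¹ * (A u + A (-u)) := by
    intro u
    simp only [hA]
    rw [← ENNReal.ofReal_add (by positivity) (by positivity), Real.cosh_neg,
      show (2⁻¹ : ℝ≥0∞) = ENNReal.ofReal 2⁻¹ by
        rw [ENNReal.ofReal_inv_of_pos (by norm_num)]; simp,
      ← ENNReal.ofReal_mul (by norm_num), Real.cosh_eq (ν * u)]
    congr 1
    ring_nf
  simp only [h2]
  rw [lintegral_const_mul' _ _ (by simp), lintegral_add_left hAm, lintegral_neg_eq_self,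
    ← two_mul, ← mul_assoc, ENNReal.inv_mul_cancel (by simp) (by simp), one_mul]

/-- The exponential change of variables `t = c e ^ u`. -/
theorem lintegral_Ioi_eq_lintegral_exp {c : ℝ} (hc : 0 < c) (f : ℝ → ℝ≥0∞) :
    ∫⁻ t in Ioi (0 : ℝ), f t =
      ∫⁻ u : ℝ, ENNReal.ofReal (c * Real.exp u) * f (c * Real.exp u) := by
  have himg : (fun u : ℝ => c * Real.exp u) '' univ = Ioi 0 := by
    ext t
    simp only [image_univ, mem_range, mem_Ioi]
    constructor
    · rintro ⟨u, rfl⟩; positivity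
    · intro ht
      exact ⟨Real.log (t / c), by rw [Real.exp_log (by positivity)]; field_simp⟩
  have h := lintegral_image_eq_lintegral_abs_deriv_mul (s := univ)
    (f := fun u : ℝ => c * Real.exp u) (f' := fun u => c * Real.exp u) MeasurableSet.univ
    (fun u _ => ((Real.hasDerivAt_exp u).const_mul c).hasDerivWithinAt)
    (fun u _ v _ huv => Real.exp_injective (mul_left_cancel₀ hc.ne' huv)) f
  rw [himg] at h
  rw [h, setLIntegral_univ]
  refine lintegral_congr fun u => ?_
  rw [abs_of_pos (by positivity)]

/-- The Bessel formula is the Laplace transform, at `1`, of the Gaussian semigroup: a Laplace vector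
is a Gaussian vector with an independent exponential variance. -/
theorem ofReal_laplaceFormula (S : Matrix (Fin d) (Fin d) ℝ) {lam : ℝ} (hlam : 0 < lam)
    {y : EuclideanSpace ℝ (Fin d)} (hy : 0 < mahalanobis S y) :
    ENNReal.ofReal (laplaceFormula S lam y) =
      ∫⁻ t in Ioi (0 : ℝ), ENNReal.ofReal (Real.exp (-t) *
        ((2 * Real.pi * (lam * t)) ^ (-((d : ℝ) / 2)) *
          Real.exp (-(mahalanobis S y ^ 2 / (2 * (lam * t)))))) := by
  set ρ := mahalanobis S y with hρ
  set ν : ℝ := (d : ℝ) / 2 - 1 with hν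
  set r := Real.sqrt (2 / lam) with hr
  have hr0 : 0 < r := Real.sqrt_pos.2 (by positivity)
  have hr2 : r ^ 2 = 2 / lam := Real.sq_sqrt (by positivity)
  have hrlam : lam = 2 / r ^ 2 := by rw [hr2]; field_simp
  -- `t + ρ² / (2 lam t) = 2 c cosh u` for `t = c e ^ u`
  set c := r * ρ / 2 with hc
  have hc0 : 0 < c := by positivity
  have hz : 0 < r * ρ := by positivity
  have hsq : Real.sqrt (lam / 2) = 1 / r := by
    rw [hr, one_div, ← Real.sqrt_inv]; congr 1; field_simp
  rw [lintegral_Ioi_eq_lintegral_exp hc0]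
  have hform : laplaceFormula S lam y =
      (2 * Real.pi * lam) ^ (-((d : ℝ) / 2)) * c ^ (-ν) * (2 * besselK ν (r * ρ)) := by
    have e0 : laplaceFormula S lam y = 2 / (lam * (2 * Real.pi) ^ ((d : ℝ) / 2)) *
        (besselK ν (r * ρ) / (Real.sqrt (lam / 2) * ρ) ^ ν) := rfl
    rw [e0, hsq]
    have e1 : 1 / r * ρ = lam * c := by rw [hc, hrlam]; field_simp
    have e2 : (lam * c) ^ ν = lam ^ ((d : ℝ) / 2) / lam * c ^ ν := by
      rw [Real.mul_rpow hlam.le hc0.le, hν, Real.rpow_sub hlam, Real.rpow_one]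
    generalize besselK ν (r * ρ) = k
    rw [e1, e2, Real.rpow_neg (by positivity), Real.rpow_neg hc0.le,
      Real.mul_rpow (by positivity) hlam.le]
    field_simp
  rw [hform, ENNReal.ofReal_mul (by positivity), two_mul_besselK ν hz,
    ← lintegral_const_mul' _ _ ENNReal.ofReal_ne_top]
  refine lintegral_congr fun u => ?_
  rw [← ENNReal.ofReal_mul (by positivity), ← ENNReal.ofReal_mul (by positivity)]
  congr 1
  have hpow : (2 * Real.pi * (lam * (c * Real.exp u))) ^ (-((d : ℝ) / 2)) =
      (2 * Real.pi * lam) ^ (-((d : ℝ) / 2)) * (c ^ (-ν) / c) * Real.exp (-((d : ℝ) / 2) * u) := by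
    rw [show 2 * Real.pi * (lam * (c * Real.exp u)) = 2 * Real.pi * lam * c * Real.exp u by ring,
      Real.mul_rpow (by positivity) (by positivity), Real.mul_rpow (by positivity) hc0.le,
      ← Real.exp_mul]
    congr 2
    · rw [show -((d : ℝ) / 2) = -ν - 1 by rw [hν]; ring, Real.rpow_sub hc0, Real.rpow_one]
    · ring
  have hexp : -(r * ρ) * Real.cosh u =
      -(c * Real.exp u) + -(ρ ^ 2 / (2 * (lam * (c * Real.exp u)))) := by
    rw [Real.cosh_eq, hc, hrlam, Real.exp_neg]
    field_simp
    ring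
  rw [hpow, hexp, Real.exp_add]
  have hν2 : Real.exp (-ν * u) = Real.exp (-((d : ℝ) / 2) * u) * Real.exp u := by
    rw [← Real.exp_add]; congr 1; rw [hν]; ring
  rw [hν2]
  field_simp

/-! ### The Laplace density and its resolvent identity -/

/-- The Laplace density as an exponential mixture of Gaussian densities. -/
def laplaceDensity (S : Matrix (Fin d) (Fin d) ℝ) (lam : ℝ) (y : E) : ℝ≥0∞ :=
  ∫⁻ t in Ioi (0 : ℝ), ENNReal.ofReal (Real.exp (-t)) * gaussDensity S (lam * t) y

/-- The mixture of the Gaussian densities with respect to the exponential law conditioned to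
`t ≤ η`. -/
def smoothingDensity (S : Matrix (Fin d) (Fin d) ℝ) (lam η : ℝ) (y : E) : ℝ≥0∞ :=
  (ENNReal.ofReal (1 - Real.exp (-η)))⁻¹ *
    ∫⁻ t in Ioc (0 : ℝ) η, ENNReal.ofReal (Real.exp (-t)) * gaussDensity S (lam * t) y

section

variable (S : Matrix (Fin d) (Fin d) ℝ) (lam : ℝ)

theorem measurable_exp_mul_gaussDensity_uncurry : Measurable fun p : ℝ × E =>
    ENNReal.ofReal (Real.exp (-p.1)) * gaussDensity S (lam * p.1) p.2 := by
  have h : Measurable fun p : ℝ × E => gaussDensity S (lam * p.1) p.2 :=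
    (measurable_gaussDensity_uncurry S).comp
      ((measurable_fst.const_mul lam).prodMk measurable_snd)
  exact Measurable.mul (by fun_prop) h

theorem measurable_setLIntegral_exp_mul_gaussDensity (A : Set ℝ) : Measurable fun y : E =>
    ∫⁻ t in A, ENNReal.ofReal (Real.exp (-t)) * gaussDensity S (lam * t) y :=
  Measurable.lintegral_prod_left' (measurable_exp_mul_gaussDensity_uncurry S lam)

theorem measurable_laplaceDensity : Measurable (laplaceDensity S lam) :=
  measurable_setLIntegral_exp_mul_gaussDensity S lam _

theorem measurable_smoothingDensity (η : ℝ) : Measurable (smoothingDensity S lam η) :=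
  (measurable_setLIntegral_exp_mul_gaussDensity S lam _).const_mul _

theorem measurable_exp_mul_gaussDensity (y : E) : Measurable fun t : ℝ =>
    ENNReal.ofReal (Real.exp (-t)) * gaussDensity S (lam * t) y :=
  (measurable_exp_mul_gaussDensity_uncurry S lam).comp measurable_prodMk_right

/-- Fubini for the exponential mixtures of Gaussian densities. -/
theorem lintegral_mul_setLIntegral_exp_mul_gaussDensity {A : Set ℝ} {h : E → ℝ≥0∞}
    (hh : Measurable h) :
    ∫⁻ y, h y * ∫⁻ t in A, ENNReal.ofReal (Real.exp (-t)) * gaussDensity S (lam * t) y =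
      ∫⁻ t in A, ENNReal.ofReal (Real.exp (-t)) * ∫⁻ y, h y * gaussDensity S (lam * t) y := by
  have h1 : ∀ y, h y * ∫⁻ t in A, ENNReal.ofReal (Real.exp (-t)) * gaussDensity S (lam * t) y =
      ∫⁻ t in A, h y * (ENNReal.ofReal (Real.exp (-t)) * gaussDensity S (lam * t) y) := fun y =>
    (lintegral_const_mul _ (measurable_exp_mul_gaussDensity S lam y)).symm
  simp only [h1]
  rw [lintegral_lintegral_swap]
  · refine lintegral_congr fun t => ?_
    rw [← lintegral_const_mul' _ _ ENNReal.ofReal_ne_top]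
    exact lintegral_congr fun y => mul_left_comm _ _ _
  · exact ((hh.comp measurable_fst).mul
      ((measurable_exp_mul_gaussDensity_uncurry S lam).comp measurable_swap)).aemeasurable

end

theorem one_sub_exp_neg_pos {η : ℝ} (hη : 0 < η) : 0 < 1 - Real.exp (-η) := by
  simpa using hη

theorem lintegral_Ioc_exp_neg {η : ℝ} (hη : 0 ≤ η) :
    ∫⁻ t in Ioc (0 : ℝ) η, ENNReal.ofReal (Real.exp (-t)) = ENNReal.ofReal (1 - Real.exp (-η)) := by
  have hc : Continuous fun t : ℝ => Real.exp (-t) := by fun_prop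
  rw [← ofReal_integral_eq_lintegral_ofReal
    ((hc.intervalIntegrable 0 η).1) (Eventually.of_forall fun _ => (Real.exp_pos _).le),
    ← intervalIntegral.integral_of_le hη]
  congr 1
  simp

theorem lintegral_Ioi_exp_neg_mul {k : ℝ} (hk : 0 < k) :
    ∫⁻ t in Ioi (0 : ℝ), ENNReal.ofReal (Real.exp (-(k * t))) = ENNReal.ofReal (1 / k) := by
  have hi := integrableOn_exp_mul_Ioi (neg_neg_of_pos hk) 0
  have hv := integral_exp_mul_Ioi (neg_neg_of_pos hk) 0
  simp only [neg_mul] at hi hv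
  rw [← ofReal_integral_eq_lintegral_ofReal hi (Eventually.of_forall fun _ => (Real.exp_pos _).le),
    hv]
  congr 1
  simp

section

variable {S : Matrix (Fin d) (Fin d) ℝ} (hS : S.PosDef) (hdet : S.det = 1)
  {lam : ℝ} (hlam : 0 < lam)
include hlam

theorem laplaceDensity_ne_zero (y : E) : laplaceDensity S lam y ≠ 0 := by
  rw [laplaceDensity, Ne, setLIntegral_eq_zero_iff measurableSet_Ioi
    (measurable_exp_mul_gaussDensity S lam y)]
  intro h
  have h2 : ∀ᵐ t : ℝ, ¬ t ∈ Ioi (0 : ℝ) := by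
    filter_upwards [h] with t ht htp
    have := ht htp
    rw [mul_eq_zero] at this
    rcases this with h3 | h3
    · exact absurd h3 (by simp [Real.exp_pos])
    · exact gaussDensity_ne_zero S (mul_pos hlam htp) y h3
  have h3 : volume (Ioi (0 : ℝ)) = 0 := measure_eq_zero_iff_ae_notMem.2 h2
  simp at h3

theorem smoothingDensity_ne_zero {η : ℝ} (hη : 0 < η) (y : E) :
    smoothingDensity S lam η y ≠ 0 := by
  rw [smoothingDensity]
  refine mul_ne_zero (ENNReal.inv_ne_zero.2 ENNReal.ofReal_ne_top) ?_
  rw [Ne, setLIntegral_eq_zero_iff measurableSet_Ioc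
    (measurable_exp_mul_gaussDensity S lam y)]
  intro h
  have h2 : ∀ᵐ t : ℝ, ¬ t ∈ Ioc (0 : ℝ) η := by
    filter_upwards [h] with t ht htp
    have := ht htp
    rw [mul_eq_zero] at this
    rcases this with h3 | h3
    · exact absurd h3 (by simp [Real.exp_pos])
    · exact gaussDensity_ne_zero S (mul_pos hlam htp.1) y h3
  have h3 : volume (Ioc (0 : ℝ) η) = 0 := measure_eq_zero_iff_ae_notMem.2 h2
  rw [Real.volume_Ioc, sub_zero, ENNReal.ofReal_eq_zero] at h3
  linarith

include hS hdet

theorem lintegral_laplaceDensity : ∫⁻ y : E, laplaceDensity S lam y = 1 := by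
  have h := lintegral_mul_setLIntegral_exp_mul_gaussDensity S lam (A := Ioi 0)
    (h := fun _ => 1) measurable_const
  simp only [one_mul] at h
  have h2 := lintegral_Ioi_exp_neg_mul one_pos
  simp only [one_mul, div_one, ENNReal.ofReal_one] at h2
  unfold laplaceDensity
  rw [h, ← h2]
  refine setLIntegral_congr_fun measurableSet_Ioi fun t ht => ?_
  simp only [lintegral_gaussDensity hS hdet (mul_pos hlam ht), mul_one]

/-- Exponential moments of the Laplace density; `729 / 89 = 1 / (1 - 640 / 729)` comes from
integrating the Gaussian bound against `e^{-t}`. -/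
theorem lintegral_exp_mul_laplaceDensity_le (hd : 1 ≤ d) :
    ∫⁻ y : E, ENNReal.ofReal (Real.exp (8 / 9 * Real.sqrt (2 / (lam * lambdaMax S)) * ‖y‖)) *
      laplaceDensity S lam y ≤ ENNReal.ofReal (729 / 89 * (1 / 10) ^ (-((d : ℝ) / 2))) := by
  unfold laplaceDensity
  rw [lintegral_mul_setLIntegral_exp_mul_gaussDensity S lam (by fun_prop)]
  have h2 := lintegral_Ioi_exp_neg_mul (show (0 : ℝ) < 89 / 729 by norm_num)
  rw [show (1 : ℝ) / (89 / 729) = 729 / 89 by norm_num] at h2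
  rw [ENNReal.ofReal_mul (by norm_num), ← h2, ← lintegral_mul_const' _ _ ENNReal.ofReal_ne_top]
  refine setLIntegral_mono' measurableSet_Ioi fun t ht => ?_
  refine (mul_le_mul_right (lintegral_exp_mul_gaussDensity_le hS hdet hd hlam ht) _).trans ?_
  rw [ENNReal.ofReal_mul (by positivity), ← mul_assoc, ← ENNReal.ofReal_mul (by positivity),
    ← Real.exp_add]
  refine le_of_eq ?_
  congr 3
  ring

theorem lintegral_smoothingDensity {η : ℝ} (hη : 0 < η) :
    ∫⁻ y : E, smoothingDensity S lam η y = 1 := by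
  have hc := one_sub_exp_neg_pos hη
  have h := lintegral_mul_setLIntegral_exp_mul_gaussDensity S lam (A := Ioc 0 η)
    (h := fun _ => 1) measurable_const
  simp only [one_mul] at h
  unfold smoothingDensity
  rw [lintegral_const_mul _ (measurable_setLIntegral_exp_mul_gaussDensity S lam _), h]
  have : ∫⁻ t in Ioc 0 η, ENNReal.ofReal (Real.exp (-t)) * ∫⁻ y, gaussDensity S (lam * t) y =
      ENNReal.ofReal (1 - Real.exp (-η)) := by
    rw [← lintegral_Ioc_exp_neg hη.le]
    refine setLIntegral_congr_fun measurableSet_Ioc fun t ht => ?_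
    simp only [lintegral_gaussDensity hS hdet (mul_pos hlam ht.1), mul_one]
  rw [this]
  exact ENNReal.inv_mul_cancel (by simpa using hc) ENNReal.ofReal_ne_top

theorem lintegral_sq_mul_smoothingDensity_le (hd : 1 ≤ d) {η : ℝ} (hη : 0 < η) :
    ∫⁻ y : E, ENNReal.ofReal (‖y‖ ^ 2) * smoothingDensity S lam η y ≤
      ENNReal.ofReal (4 * lambdaMax S * (lam * η) * (1 / 2) ^ (-((d : ℝ) / 2))) := by
  have hl := lambdaMax_pos hd hS
  have hc := one_sub_exp_neg_pos hη
  set b := ENNReal.ofReal (4 * lambdaMax S * (lam * η) * (1 / 2) ^ (-((d : ℝ) / 2)))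
  have h : ∀ y : E, ENNReal.ofReal (‖y‖ ^ 2) * smoothingDensity S lam η y =
      (ENNReal.ofReal (1 - Real.exp (-η)))⁻¹ * (ENNReal.ofReal (‖y‖ ^ 2) *
        ∫⁻ t in Ioc (0 : ℝ) η, ENNReal.ofReal (Real.exp (-t)) * gaussDensity S (lam * t) y) :=
    fun y => mul_left_comm _ _ _
  simp only [h]
  rw [lintegral_const_mul' _ _ (by simpa using hc),
    lintegral_mul_setLIntegral_exp_mul_gaussDensity S lam (by fun_prop)]
  have h2 : ∫⁻ t in Ioc 0 η, ENNReal.ofReal (Real.exp (-t)) *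
      ∫⁻ y : E, ENNReal.ofReal (‖y‖ ^ 2) * gaussDensity S (lam * t) y ≤
      ENNReal.ofReal (1 - Real.exp (-η)) * b := by
    rw [← lintegral_Ioc_exp_neg hη.le, ← lintegral_mul_const' _ _ ENNReal.ofReal_ne_top]
    refine setLIntegral_mono' measurableSet_Ioc fun t ht => ?_
    refine mul_le_mul_right
      ((lintegral_sq_mul_gaussDensity_le hS hdet hd (mul_pos hlam ht.1)).trans ?_) _
    refine ENNReal.ofReal_le_ofReal ?_
    have := ht.2
    gcongr
  refine (mul_le_mul_right h2 _).trans ?_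
  rw [← mul_assoc, ENNReal.inv_mul_cancel (by simpa using hc) ENNReal.ofReal_ne_top, one_mul]

/-- Convolving the Laplace density with a Gaussian of its own semigroup shifts the exponential
mixing time. -/
theorem lintegral_gaussDensity_mul_laplaceDensity {η : ℝ} (hη : 0 < η) (x : E) :
    ENNReal.ofReal (Real.exp (-η)) *
        ∫⁻ y, gaussDensity S (lam * η) (x - y) * laplaceDensity S lam y =
      ∫⁻ t in Ioi η, ENNReal.ofReal (Real.exp (-t)) * gaussDensity S (lam * t) x := by
  have hm : Measurable fun y : E => gaussDensity S (lam * η) (x - y) :=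
    (measurable_gaussDensity S _).comp (measurable_id.const_sub x)
  unfold laplaceDensity
  rw [lintegral_mul_setLIntegral_exp_mul_gaussDensity S lam hm,
    ← lintegral_const_mul' _ _ ENNReal.ofReal_ne_top,
    ← lintegral_indicator measurableSet_Ioi, ← lintegral_indicator measurableSet_Ioi,
    ← lintegral_sub_right_eq_self (μ := volume) _ η]
  refine lintegral_congr fun t => ?_
  by_cases ht : η < t
  · have ht' : 0 < t - η := by linarith
    rw [indicator_of_mem (show t - η ∈ Ioi (0 : ℝ) from ht'),
      indicator_of_mem (show t ∈ Ioi η from ht),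
      lintegral_gaussDensity_mul_gaussDensity hS hdet (mul_pos hlam hη) (mul_pos hlam ht'),
      ← mul_assoc, ← ENNReal.ofReal_mul (Real.exp_pos _).le, ← Real.exp_add]
    ring_nf
  · rw [indicator_of_notMem (by simpa using ht), indicator_of_notMem (by simpa using ht)]

/-- **Resolvent identity.** The Laplace density is a convex combination of the smoothing density and
of its own convolution with a Gaussian density. -/
theorem laplaceDensity_resolvent {η : ℝ} (hη : 0 < η) (x : E) :
    laplaceDensity S lam x = ENNReal.ofReal (1 - Real.exp (-η)) * smoothingDensity S lam η x +
      ENNReal.ofReal (Real.exp (-η)) *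
        ∫⁻ y, gaussDensity S (lam * η) (x - y) * laplaceDensity S lam y := by
  have hc := one_sub_exp_neg_pos hη
  rw [lintegral_gaussDensity_mul_laplaceDensity hS hdet hlam hη, smoothingDensity, ← mul_assoc,
    ENNReal.mul_inv_cancel (by simpa using hc) ENNReal.ofReal_ne_top, one_mul, laplaceDensity,
    ← Ioc_union_Ioi_eq_Ioi hη.le, lintegral_union measurableSet_Ioi]
  exact Set.disjoint_left.2 fun t h1 h2 => absurd h1.2 (not_le.2 h2)

end

/-! ### Deconvolution -/

theorem measurable_uncurry_sub {k : E → ℝ≥0∞} (hk : Measurable k) :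
    Measurable (Function.uncurry fun x θ : E => k (x - θ)) :=
  hk.comp (measurable_fst.sub measurable_snd)

theorem lintegral_mul_mixtureDensity {k : E → E → ℝ≥0∞} (hk : Measurable (Function.uncurry k))
    {h : E → ℝ≥0∞} (hh : Measurable h) (G : Measure E) [SFinite G] :
    ∫⁻ y, h y * mixtureDensity k G y = ∫⁻ θ, (∫⁻ y, h y * k y θ) ∂G := by
  unfold mixtureDensity
  rw [lintegral_lintegral_swap]
  · refine lintegral_congr fun y => ?_
    have hky : Measurable fun θ => k y θ := hk.comp measurable_prodMk_left
    exact (lintegral_const_mul _ hky).symm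
  · exact ((hh.comp measurable_snd).mul (hk.comp measurable_swap)).aemeasurable

/-- The mixture of translated Laplace densities with mixing measure `G`. -/
def laplaceMixture (S : Matrix (Fin d) (Fin d) ℝ) (lam : ℝ) (G : Measure E) : E → ℝ≥0∞ :=
  mixtureDensity (fun x θ => laplaceDensity S lam (x - θ)) G

theorem measurable_laplaceMixture (S : Matrix (Fin d) (Fin d) ℝ) (lam : ℝ) (G : Measure E)
    [SFinite G] : Measurable (laplaceMixture S lam G) :=
  measurable_mixtureDensity (measurable_uncurry_sub (measurable_laplaceDensity S lam))

section

variable {S : Matrix (Fin d) (Fin d) ℝ} (hS : S.PosDef) (hdet : S.det = 1)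
  {lam : ℝ} (hlam : 0 < lam)
include hS hdet

theorem lintegral_gaussDensity_mul_lintegral {v : ℝ} (hv : 0 < v) {h : E → ℝ≥0∞}
    (hh : Measurable h) : ∫⁻ x, ∫⁻ y, gaussDensity S v (x - y) * h y = ∫⁻ y, h y := by
  rw [lintegral_lintegral_swap]
  · refine lintegral_congr fun y => ?_
    have hg : Measurable fun x : E => gaussDensity S v (x - y) :=
      (measurable_gaussDensity S v).comp (measurable_id.sub_const y)
    rw [lintegral_mul_const _ hg,
      lintegral_sub_right_eq_self (μ := volume) (fun x => gaussDensity S v x) y,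
      lintegral_gaussDensity hS hdet hv, one_mul]
  · exact ((measurable_uncurry_sub (measurable_gaussDensity S v)).mul
      (hh.comp measurable_snd)).aemeasurable

include hlam

/-- The resolvent identity for mixtures. -/
theorem laplaceMixture_resolvent {η : ℝ} (hη : 0 < η) (G : Measure E) [SFinite G]
    (x : E) :
    laplaceMixture S lam G x =
      ENNReal.ofReal (1 - Real.exp (-η)) *
          mixtureDensity (fun x θ => smoothingDensity S lam η (x - θ)) G x +
        ENNReal.ofReal (Real.exp (-η)) * ∫⁻ y, gaussDensity S (lam * η) (x - y) *
          laplaceMixture S lam G y := by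
  have hF := measurable_laplaceDensity S lam
  have hg : Measurable fun y : E => gaussDensity S (lam * η) (x - y) :=
    (measurable_gaussDensity S _).comp (measurable_id.const_sub x)
  have hKx : Measurable fun θ : E => smoothingDensity S lam η (x - θ) :=
    (measurable_smoothingDensity S lam η).comp (measurable_id.const_sub x)
  rw [laplaceMixture, lintegral_mul_mixtureDensity (measurable_uncurry_sub hF) hg, mixtureDensity,
    mixtureDensity,
    ← lintegral_const_mul _ hKx, ← lintegral_const_mul' _ _ ENNReal.ofReal_ne_top,
    ← lintegral_add_left (hKx.const_mul _)]
  refine lintegral_congr fun θ => ?_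
  have hshift : ∫⁻ y, gaussDensity S (lam * η) (x - θ - y) * laplaceDensity S lam y =
      ∫⁻ y, gaussDensity S (lam * η) (x - y) * laplaceDensity S lam (y - θ) := by
    rw [← lintegral_sub_right_eq_self (μ := volume) _ θ]
    refine lintegral_congr fun y => ?_
    rw [show x - θ - (y - θ) = x - y by abel]
  rw [laplaceDensity_resolvent hS hdet hlam hη, hshift]

theorem lintegral_laplaceMixture (G : Measure E) [IsProbabilityMeasure G] :
    ∫⁻ x, laplaceMixture S lam G x = 1 := by
  refine lintegral_mixtureDensity (measurable_uncurry_sub (measurable_laplaceDensity S lam))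
    fun θ => ?_
  rw [lintegral_sub_right_eq_self (μ := volume) (fun y => laplaceDensity S lam y) θ]
  exact lintegral_laplaceDensity hS hdet hlam

/-- **Deconvolution.** By the resolvent identity the smoothed mixing measures are a bounded operator
of norm `O(1/η)` applied to the Laplace mixtures. -/
theorem lintegral_tsub_smoothingDensity_le {η : ℝ} (hη : 0 < η) (G G' : Measure E)
    [IsProbabilityMeasure G] [IsProbabilityMeasure G'] :
    ENNReal.ofReal (1 - Real.exp (-η)) *
        ∫⁻ x, (mixtureDensity (fun x θ => smoothingDensity S lam η (x - θ)) G x -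
          mixtureDensity (fun x θ => smoothingDensity S lam η (x - θ)) G' x) ≤
      (∫⁻ x, (laplaceMixture S lam G x - laplaceMixture S lam G' x)) +
        ∫⁻ x, (laplaceMixture S lam G' x - laplaceMixture S lam G x) := by
  have hres := laplaceMixture_resolvent hS hdet hlam hη G
  have hres' := laplaceMixture_resolvent hS hdet hlam hη G'
  have hpm := measurable_laplaceMixture S lam G
  have hpm' := measurable_laplaceMixture S lam G'
  have hint := lintegral_laplaceMixture hS hdet hlam G
  set p := laplaceMixture S lam G
  set p' := laplaceMixture S lam G'
  set a := mixtureDensity (fun x θ => smoothingDensity S lam η (x - θ)) G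
  set b := mixtureDensity (fun x θ => smoothingDensity S lam η (x - θ)) G'
  set c := ENNReal.ofReal (1 - Real.exp (-η))
  set e := ENNReal.ofReal (Real.exp (-η))
  have he1 : e ≤ 1 := by
    rw [ENNReal.ofReal_le_one, Real.exp_le_one_iff]; linarith
  have hgx : ∀ x : E, Measurable fun y => gaussDensity S (lam * η) (x - y) := fun x =>
    (measurable_gaussDensity S _).comp (measurable_id.const_sub x)
  have hfin : ∀ᵐ x, p x ≠ ∞ := by
    filter_upwards [ae_lt_top hpm (by rw [hint]; simp)] with x hx using hx.ne
  calc c * ∫⁻ x, (a x - b x) = ∫⁻ x, c * (a x - b x) :=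
        (lintegral_const_mul' _ _ ENNReal.ofReal_ne_top).symm
    _ ≤ ∫⁻ x, ((p x - p' x) + ∫⁻ y, gaussDensity S (lam * η) (x - y) * (p' y - p y)) := by
        refine lintegral_mono_ae ?_
        filter_upwards [hfin] with x hx
        rw [ENNReal.mul_sub (fun _ _ => ENNReal.ofReal_ne_top), tsub_le_iff_left]
        set T := ∫⁻ y, gaussDensity S (lam * η) (x - y) * p y
        set T' := ∫⁻ y, gaussDensity S (lam * η) (x - y) * p' y
        set U := ∫⁻ y, gaussDensity S (lam * η) (x - y) * (p' y - p y)
        have hT : T' ≤ T + U := by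
          have hm : Measurable fun y => gaussDensity S (lam * η) (x - y) * p y := (hgx x).mul hpm
          rw [← lintegral_add_left hm]
          refine lintegral_mono fun y => ?_
          rw [← mul_add]
          gcongr
          exact le_add_tsub
        have heT : e * T ≠ ∞ := by
          refine ne_top_of_le_ne_top hx ?_
          rw [hres x]; exact le_add_self
        refine (ENNReal.add_le_add_iff_right heT).1 ?_
        calc c * a x + e * T = p x := (hres x).symm
          _ ≤ p' x + (p x - p' x) := le_add_tsub
          _ = c * b x + e * T' + (p x - p' x) := by rw [hres' x]
          _ ≤ c * b x + (e * T + 1 * U) + (p x - p' x) := by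
              gcongr
              calc e * T' ≤ e * (T + U) := by gcongr
                _ = e * T + e * U := mul_add _ _ _
                _ ≤ e * T + 1 * U := by gcongr
          _ = c * b x + (p x - p' x + U) + e * T := by rw [one_mul]; ring
    _ = _ := by
        have hm : Measurable fun x => p x - p' x := hpm.sub hpm'
        have hm' : Measurable fun x => p' x - p x := hpm'.sub hpm
        rw [lintegral_add_left hm,
          lintegral_gaussDensity_mul_lintegral hS hdet (by positivity) hm']

/-- The Wasserstein distance of the mixing measures is controlled by the total variation distance
of the Laplace mixtures, up to the second moment `O(η)` of the smoothing kernel. -/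
theorem wasserstein_sq_le_laplace (hd : 1 ≤ d) {η : ℝ} (hη : 0 < η) (G G' : Measure E)
    [IsProbabilityMeasure G] [IsProbabilityMeasure G'] {D : ℝ}
    (hD : ∀ᵐ θ ∂G, ∀ᵐ θ' ∂G', ‖θ - θ'‖ ≤ D) :
    wasserstein 2 G G' ^ 2 ≤
      4 * ENNReal.ofReal (4 * lambdaMax S * (lam * η) * (1 / 2) ^ (-((d : ℝ) / 2))) +
      ENNReal.ofReal (D ^ 2) * ((ENNReal.ofReal (1 - Real.exp (-η)))⁻¹ *
        ((∫⁻ x, (laplaceMixture S lam G x - laplaceMixture S lam G' x)) +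
          ∫⁻ x, (laplaceMixture S lam G' x - laplaceMixture S lam G x))) := by
  refine (wasserstein_sq_le_of_smoothing
    (measurable_uncurry_sub (measurable_smoothingDensity S lam η))
    (fun z θ => smoothingDensity_ne_zero hlam hη _) (fun θ => ?_)
    (s := ENNReal.ofReal (4 * lambdaMax S * (lam * η) * (1 / 2) ^ (-((d : ℝ) / 2))))
    (fun θ => ?_) hD).trans ?_
  · rw [lintegral_sub_right_eq_self (μ := volume) (fun y => smoothingDensity S lam η y) θ]
    exact lintegral_smoothingDensity hS hdet hlam hη
  · rw [lintegral_sub_right_eq_self (μ := volume)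
      (fun y => ENNReal.ofReal (‖y‖ ^ 2) * smoothingDensity S lam η y) θ]
    exact lintegral_sq_mul_smoothingDensity_le hS hdet hlam hd hη
  · gcongr
    rw [← ENNReal.div_eq_inv_mul, ENNReal.le_div_iff_mul_le (Or.inl (by simpa using hη))
      (Or.inl ENNReal.ofReal_ne_top), mul_comm]
    exact lintegral_tsub_smoothingDensity_le hS hdet hlam hη G G'

end

/-! ### Tails of Laplace mixtures and the weighted Hellinger distance -/

theorem mahalanobis_pos (hd : 1 ≤ d) {S : Matrix (Fin d) (Fin d) ℝ} (hS : S.PosDef) {y : E}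
    (hy : y ≠ 0) : 0 < mahalanobis S y := by
  have h := norm_le_mahalanobis hd hS y
  have h2 : 0 < ‖y‖ := norm_pos_iff.2 hy
  by_contra h3
  have h4 : mahalanobis S y = 0 := le_antisymm (not_lt.1 h3) (mahalanobis_nonneg S y)
  rw [h4, mul_zero] at h
  linarith

theorem laplaceKernel_eq_laplaceDensity (hd : 1 ≤ d) {S : Matrix (Fin d) (Fin d) ℝ}
    (hS : S.PosDef) {lam : ℝ} (hlam : 0 < lam) {x θ : E} (h : x ≠ θ) :
    laplaceKernel S lam x θ = laplaceDensity S lam (x - θ) := by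
  rw [laplaceKernel, if_neg h,
    ofReal_laplaceFormula S hlam (mahalanobis_pos hd hS (sub_ne_zero.2 h)), laplaceDensity]
  refine lintegral_congr fun t => ?_
  rw [gaussDensity, ENNReal.ofReal_mul (Real.exp_pos _).le]

/-- The value of the kernel at `x = θ` is irrelevant: a mixing measure has at most countably many
atoms. -/
theorem mixtureDensity_laplaceKernel_ae_eq (hd : 1 ≤ d) {S : Matrix (Fin d) (Fin d) ℝ}
    (hS : S.PosDef) {lam : ℝ} (hlam : 0 < lam) (G : Measure E) [SFinite G] :
    mixtureDensity (laplaceKernel S lam) G =ᵐ[volume] laplaceMixture S lam G := by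
  have : Nonempty (Fin d) := ⟨⟨0, hd⟩⟩
  have hcount : {x : E | 0 < G {x}}.Countable :=
    Measure.countable_meas_pos_of_disjoint_iUnion (fun x => measurableSet_singleton x)
      fun x y hxy => by simpa [Function.onFun] using hxy
  have hae : ∀ᵐ x : E, x ∉ {x : E | 0 < G {x}} :=
    measure_eq_zero_iff_ae_notMem.1 (hcount.measure_zero volume)
  filter_upwards [hae] with x hx
  have hx0 : G {x} = 0 := by simpa using hx
  refine lintegral_congr_ae ?_
  filter_upwards [measure_eq_zero_iff_ae_notMem.1 hx0] with θ hθ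
  exact laplaceKernel_eq_laplaceDensity hd hS hlam fun h => hθ h.symm

section

variable {S : Matrix (Fin d) (Fin d) ℝ} (hS : S.PosDef) (hdet : S.det = 1)
  {lam : ℝ} (hlam : 0 < lam)

include hlam in
theorem laplaceMixture_ne_zero (G : Measure E) [IsProbabilityMeasure G] (x : E) :
    laplaceMixture S lam G x ≠ 0 :=
  mixtureDensity_ne_zero (measurable_uncurry_sub (measurable_laplaceDensity S lam))
    (fun _ _ => laplaceDensity_ne_zero hlam _) x

include hS hdet hlam

theorem laplaceMixture_ae_ne_top (G : Measure E) [IsProbabilityMeasure G] :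
    ∀ᵐ x, laplaceMixture S lam G x ≠ ∞ := by
  filter_upwards [ae_lt_top (measurable_laplaceMixture S lam G)
    (by rw [lintegral_laplaceMixture hS hdet hlam G]; simp)] with x hx using hx.ne

/-- Exponential tail of a Laplace mixture, from the exponential moments of the kernel. -/
theorem setLIntegral_laplaceMixture_le (hd : 1 ≤ d) (G : Measure E) [IsProbabilityMeasure G]
    {r : ℝ} (hG : ∀ᵐ θ ∂G, ‖θ‖ ≤ r) (R : ℝ) :
    ∫⁻ x in {x : E | R < ‖x‖}, laplaceMixture S lam G x ≤
      ENNReal.ofReal (Real.exp (8 / 9 * Real.sqrt (2 / (lam * lambdaMax S)) * r) *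
        (729 / 89 * (1 / 10) ^ (-((d : ℝ) / 2))) *
        Real.exp (-(8 / 9 * Real.sqrt (2 / (lam * lambdaMax S)) * R))) := by
  have hmom := lintegral_exp_mul_laplaceDensity_le hS hdet hlam hd
  set k := 8 / 9 * Real.sqrt (2 / (lam * lambdaMax S)) with hk
  set M := 729 / 89 * (1 / 10 : ℝ) ^ (-((d : ℝ) / 2)) with hM
  have hk0 : 0 ≤ k := by positivity
  have hM0 : 0 ≤ M := by positivity
  have hset : MeasurableSet {x : E | R < ‖x‖} := measurableSet_lt measurable_const measurable_norm
  have hmix : ∫⁻ x, ENNReal.ofReal (Real.exp (k * ‖x‖)) * laplaceMixture S lam G x ≤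
      ENNReal.ofReal (Real.exp (k * r)) * ENNReal.ofReal M := by
    rw [laplaceMixture, lintegral_mul_mixtureDensity
      (measurable_uncurry_sub (measurable_laplaceDensity S lam)) (by fun_prop)]
    calc _ ≤ ∫⁻ θ, ENNReal.ofReal (Real.exp (k * r)) * ENNReal.ofReal M ∂G := ?_
      _ = _ := by simp
    refine lintegral_mono_ae ?_
    filter_upwards [hG] with θ hθ
    rw [← lintegral_add_right_eq_self (μ := volume) _ θ]
    refine le_trans ?_ (mul_le_mul_right hmom _)
    rw [← lintegral_const_mul' _ _ ENNReal.ofReal_ne_top]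
    refine lintegral_mono fun y => ?_
    rw [← mul_assoc, ← ENNReal.ofReal_mul (Real.exp_pos _).le, ← Real.exp_add, add_sub_cancel_right]
    refine mul_le_mul_left (ENNReal.ofReal_le_ofReal (Real.exp_le_exp.2 ?_)) _
    have h1 : k * ‖y + θ‖ ≤ k * (‖y‖ + r) :=
      mul_le_mul_of_nonneg_left ((norm_add_le y θ).trans (by linarith)) hk0
    linarith
  calc ∫⁻ x in {x : E | R < ‖x‖}, laplaceMixture S lam G x
      ≤ ∫⁻ x in {x : E | R < ‖x‖}, ENNReal.ofReal (Real.exp (-(k * R))) *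
          (ENNReal.ofReal (Real.exp (k * ‖x‖)) * laplaceMixture S lam G x) := by
        refine setLIntegral_mono' hset fun x hx => ?_
        rw [← mul_assoc, ← ENNReal.ofReal_mul (Real.exp_pos _).le, ← Real.exp_add]
        refine le_mul_of_one_le_left' ?_
        rw [ENNReal.one_le_ofReal, Real.one_le_exp_iff]
        have : k * R ≤ k * ‖x‖ := mul_le_mul_of_nonneg_left (le_of_lt hx) hk0
        linarith
    _ ≤ ∫⁻ x, ENNReal.ofReal (Real.exp (-(k * R))) *
          (ENNReal.ofReal (Real.exp (k * ‖x‖)) * laplaceMixture S lam G x) :=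
        setLIntegral_le_lintegral _ _
    _ ≤ ENNReal.ofReal (Real.exp (-(k * R))) *
          (ENNReal.ofReal (Real.exp (k * r)) * ENNReal.ofReal M) := by
        rw [lintegral_const_mul' _ _ ENNReal.ofReal_ne_top]
        gcongr
    _ = _ := by
        rw [← ENNReal.ofReal_mul (by positivity), ← ENNReal.ofReal_mul (by positivity)]
        congr 1
        ring

end

theorem tsub_le_sq_sqrt_sub_sqrt {p q : ℝ≥0∞} (hp : p ≠ ∞) (hq : q ≠ ∞) {s : ℝ} (hs : 0 < s) :
    p - q ≤ ENNReal.ofReal s * (p + q) + ENNReal.ofReal (1 / (2 * s)) *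
      ENNReal.ofReal ((Real.sqrt p.toReal - Real.sqrt q.toReal) ^ 2) := by
  lift p to NNReal using hp
  lift q to NNReal using hq
  simp only [ENNReal.coe_toReal]
  rw [tsub_le_iff_left, ← ENNReal.ofReal_coe_nnreal (p := p), ← ENNReal.ofReal_coe_nnreal (p := q),
    ← ENNReal.ofReal_add p.coe_nonneg q.coe_nonneg, ← ENNReal.ofReal_mul hs.le,
    ← ENNReal.ofReal_mul (by positivity), ← ENNReal.ofReal_add (by positivity) (by positivity),
    ← ENNReal.ofReal_add (by positivity) (by positivity)]
  refine ENNReal.ofReal_le_ofReal ?_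
  have hu := Real.sq_sqrt p.coe_nonneg
  have hv := Real.sq_sqrt q.coe_nonneg
  set u := Real.sqrt p
  set v := Real.sqrt q
  rw [← hu, ← hv]
  have h : v ^ 2 + (s * (u ^ 2 + v ^ 2) + 1 / (2 * s) * (u - v) ^ 2) - u ^ 2 =
      1 / (2 * s) * (u - v - s * (u + v)) ^ 2 + s / 2 * (u - v) ^ 2 := by
    field_simp
    ring
  have h2 : 0 ≤ 1 / (2 * s) * (u - v - s * (u + v)) ^ 2 + s / 2 * (u - v) ^ 2 := by positivity
  linarith

/-- Comparison of the total variation and a weighted Hellinger distance: on the ball of radius `R`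
the weight is bounded below by `1 / A`, outside the tail of `p` is used. The parameter `s` balances
`|p - q| = |√p - √q| (√p + √q)`. -/
theorem lintegral_tsub_le_of_weight {p q w : E → ℝ≥0∞} (hp : Measurable p) (hq : Measurable q)
    (hp1 : ∫⁻ x, p x = 1) (hq1 : ∫⁻ x, q x = 1) {A : ℝ≥0∞} (hA : A ≠ ∞) {R s : ℝ} (hs : 0 < s)
    (hw : ∀ᵐ x, ‖x‖ ≤ R → 1 ≤ A * w x) :
    ∫⁻ x, (p x - q x) ≤ ENNReal.ofReal s * 2 + (∫⁻ x in {x : E | R < ‖x‖}, p x) +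
      ENNReal.ofReal (1 / (2 * s)) * (A * ∫⁻ x,
        ENNReal.ofReal ((Real.sqrt (p x).toReal - Real.sqrt (q x).toReal) ^ 2) * w x) := by
  have hset : MeasurableSet {x : E | R < ‖x‖} := measurableSet_lt measurable_const measurable_norm
  have hpf : ∀ᵐ x, p x < ∞ := ae_lt_top hp (by rw [hp1]; simp)
  have hqf : ∀ᵐ x, q x < ∞ := ae_lt_top hq (by rw [hq1]; simp)
  have hm1 : Measurable fun x => ENNReal.ofReal s * (p x + q x) := (hp.add hq).const_mul _
  have hm2 : Measurable fun x => {x : E | R < ‖x‖}.indicator p x := hp.indicator hset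
  have hm12 : Measurable fun x => ENNReal.ofReal s * (p x + q x) +
    {x : E | R < ‖x‖}.indicator p x := hm1.add hm2
  calc ∫⁻ x, (p x - q x)
      ≤ ∫⁻ x, (ENNReal.ofReal s * (p x + q x) + {x : E | R < ‖x‖}.indicator p x +
        ENNReal.ofReal (1 / (2 * s)) * (A *
        (ENNReal.ofReal ((Real.sqrt (p x).toReal - Real.sqrt (q x).toReal) ^ 2) * w x))) := by
        refine lintegral_mono_ae ?_
        filter_upwards [hpf, hqf, hw] with x h1 h2 h3
        by_cases hx : R < ‖x‖
        · rw [indicator_of_mem (show x ∈ {x : E | R < ‖x‖} from hx)]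
          exact tsub_le_self.trans (le_add_right le_add_self)
        · refine (tsub_le_sq_sqrt_sub_sqrt h1.ne h2.ne hs).trans ?_
          refine add_le_add le_self_add (mul_le_mul_right ?_ _)
          rw [mul_left_comm]
          exact le_mul_of_one_le_right' (h3 (not_lt.1 hx))
    _ = _ := by
        rw [lintegral_add_left hm12, lintegral_add_left hm1, lintegral_indicator hset,
          lintegral_const_mul' _ _ ENNReal.ofReal_ne_top, lintegral_add_left hp, hp1, hq1,
          lintegral_const_mul' _ _ ENNReal.ofReal_ne_top, lintegral_const_mul' _ _ hA,
          one_add_one_eq_two]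

theorem mixingMeasures_ae_mem {Θ : Set E} {G : Measure E} (hG : G ∈ mixingMeasures Θ) :
    ∀ᵐ θ ∂G, θ ∈ Θ := by
  simpa using measure_eq_zero_iff_ae_notMem.1 hG.2

/-- The tail condition bounds the misspecified fit by the true density on balls. -/
theorem TailCondition.mixtureDensity_le {Θ : Set E} {f f₀ : E → E → ℝ≥0∞} {G₀ G : Measure E}
    [IsProbabilityMeasure G₀] {C₀ C₁ α : ℝ} (h : TailCondition Θ f f₀ G₀ C₀ C₁ α) (hC₁ : 0 < C₁)
    (hG : G ∈ mixingMeasures Θ) {R : ℝ} (hR : 0 < R) {x : E} (hx : ‖x‖ ≤ R) :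
    mixtureDensity f G x ≤
      ENNReal.ofReal (C₁ * Real.exp (C₀ * R ^ α)) * mixtureDensity f₀ G₀ x := by
  have := hG.1
  have hA0 : ENNReal.ofReal (C₁ * Real.exp (C₀ * R ^ α)) ≠ 0 := by
    have : 0 < C₁ * Real.exp (C₀ * R ^ α) := by positivity
    simpa using this
  have hsup := h.2 R hR
  set A := ENNReal.ofReal (C₁ * Real.exp (C₀ * R ^ α))
  have hpt : ∀ θ ∈ Θ, ∀ θ₀ ∈ G₀.support, f x θ ≤ A * f₀ x θ₀ := by
    intro θ hθ θ₀ hθ₀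
    rw [← ENNReal.div_le_iff_le_mul (Or.inr ENNReal.ofReal_ne_top) (Or.inr hA0)]
    refine le_trans ?_ hsup
    exact le_iSup₂_of_le x hx (le_iSup₂_of_le θ hθ (le_iSup₂_of_le θ₀ hθ₀ le_rfl))
  calc mixtureDensity f G x = ∫⁻ _, mixtureDensity f G x ∂G₀ := by simp
    _ ≤ ∫⁻ θ₀, A * f₀ x θ₀ ∂G₀ := by
        refine lintegral_mono_ae ?_
        filter_upwards [Measure.support_mem_ae] with θ₀ hθ₀
        calc mixtureDensity f G x ≤ ∫⁻ _, A * f₀ x θ₀ ∂G := by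
              refine lintegral_mono_ae ?_
              filter_upwards [mixingMeasures_ae_mem hG] with θ hθ
              exact hpt θ hθ θ₀ hθ₀
          _ = A * f₀ x θ₀ := by simp
    _ = A * mixtureDensity f₀ G₀ x := lintegral_const_mul' _ _ ENNReal.ofReal_ne_top

/-- The trivial bound from the independent coupling. -/
theorem wasserstein_two_le {G G' : Measure E} [IsProbabilityMeasure G] [IsProbabilityMeasure G']
    {D : ℝ} (hD : ∀ᵐ θ ∂G, ∀ᵐ θ' ∂G', ‖θ - θ'‖ ≤ D) (hD0 : 0 ≤ D) :
    wasserstein 2 G G' ≤ ENNReal.ofReal D := by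
  have hπ : (G.prod G').map Prod.fst = G ∧ (G.prod G').map Prod.snd = G' := by simp
  refine (iInf₂_le (G.prod G') hπ).trans ?_
  have h : ∫⁻ z, ENNReal.ofReal (‖z.1 - z.2‖ ^ (2 : ℝ)) ∂(G.prod G') ≤
      ENNReal.ofReal (D ^ (2 : ℝ)) := by
    rw [lintegral_prod _ (by fun_prop)]
    calc _ ≤ ∫⁻ _, ∫⁻ _, ENNReal.ofReal (D ^ (2 : ℝ)) ∂G' ∂G := by
          refine lintegral_mono_ae ?_
          filter_upwards [hD] with θ hθ
          refine lintegral_mono_ae ?_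
          filter_upwards [hθ] with θ' h
          gcongr
      _ = _ := by simp
  calc _ ≤ (ENNReal.ofReal (D ^ (2 : ℝ))) ^ (1 / (2 : ℝ)) := by gcongr
    _ = ENNReal.ofReal D := by
        rw [ENNReal.ofReal_rpow_of_nonneg (by positivity) (by norm_num), ← Real.rpow_mul hD0]
        norm_num

/-! ### The rate -/

theorem half_le_one_sub_exp_neg {η : ℝ} (h0 : 0 < η) (h1 : η ≤ 1) :
    η / 2 ≤ 1 - Real.exp (-η) := by
  have h2 : Real.exp (-η) ≤ 1 / (1 + η) := by
    rw [Real.exp_neg, one_div]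
    exact inv_anti₀ (by positivity) (by linarith [Real.add_one_le_exp η])
  have h3 : 1 / (1 + η) ≤ 1 - η / 2 := by
    rw [div_le_iff₀ (by positivity)]
    nlinarith
  linarith

/-- `∫ (√p - √q)² p₀ / ps` is twice the square of the weighted Hellinger distance, and depends only
on the almost everywhere classes of `p` and `q`. -/
theorem lintegral_eq_two_mul_weightedHellinger_sq {p₀ ps p q p' q' : E → ℝ≥0∞}
    (hp : p =ᵐ[volume] p') (hq : q =ᵐ[volume] q') :
    ∫⁻ x, ENNReal.ofReal ((Real.sqrt (p' x).toReal - Real.sqrt (q' x).toReal) ^ 2) *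
      (p₀ x / ps x) = 2 * weightedHellinger p₀ ps p q ^ 2 := by
  have h : ∫⁻ x, ENNReal.ofReal ((Real.sqrt (p' x).toReal - Real.sqrt (q' x).toReal) ^ 2) *
      (p₀ x / ps x) = ∫⁻ x, ENNReal.ofReal ((Real.sqrt (p x).toReal -
        Real.sqrt (q x).toReal) ^ 2) * (p₀ x / ps x) := by
    refine lintegral_congr_ae ?_
    filter_upwards [hp, hq] with x h1 h2
    rw [h1, h2]
  rw [h, weightedHellinger, ← ENNReal.rpow_natCast, ← ENNReal.rpow_mul]
  norm_num
  rw [← mul_assoc, ENNReal.mul_inv_cancel (by simp) (by simp), one_mul]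

section

variable {S : Matrix (Fin d) (Fin d) ℝ} (hS : S.PosDef) (hdet : S.det = 1)
  {lam : ℝ} (hlam : 0 < lam) (hd : 1 ≤ d)
  {Θ : Set (EuclideanSpace ℝ (Fin d))} {r : ℝ} (hΘ : ∀ θ ∈ Θ, ‖θ‖ ≤ r)
  {G₀ : Measure (EuclideanSpace ℝ (Fin d))} [IsProbabilityMeasure G₀]
  {f₀ : EuclideanSpace ℝ (Fin d) → EuclideanSpace ℝ (Fin d) → ℝ≥0∞}
  {C₀ C₁ α : ℝ} (hC₁ : 0 < C₁) (hα : 1 ≤ α)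
  (hT : TailCondition Θ (laplaceKernel S lam) f₀ G₀ C₀ C₁ α)
  {Gs G G' : Measure (EuclideanSpace ℝ (Fin d))} (hGs : Gs ∈ mixingMeasures Θ)
  (hG : G ∈ mixingMeasures Θ) (hG' : G' ∈ mixingMeasures Θ)
include hS hdet hlam hd hΘ hC₁ hα hT hGs hG hG'

/-- Truncating at radius `R`, where the weight in the Hellinger distance is at least
`exp (-C₀ R ^ α) / C₁`. -/
theorem lintegral_tsub_laplaceMixture_le {R : ℝ} (hR : 1 ≤ R)
    (hH : weightedHellinger (mixtureDensity f₀ G₀) (mixtureDensity (laplaceKernel S lam) Gs)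
      (mixtureDensity (laplaceKernel S lam) G) (mixtureDensity (laplaceKernel S lam) G') ≤
      ENNReal.ofReal (Real.exp (-((Real.sqrt (2 / (lam * lambdaMax S)) + C₀ / 2) * R ^ α)))) :
    ∫⁻ x, (laplaceMixture S lam G x - laplaceMixture S lam G' x) ≤
      ENNReal.ofReal ((2 + Real.exp (8 / 9 * Real.sqrt (2 / (lam * lambdaMax S)) * r) *
        (729 / 89 * (1 / 10) ^ (-((d : ℝ) / 2))) + C₁) *
        Real.exp (-(8 / 9 * Real.sqrt (2 / (lam * lambdaMax S)) * R))) := by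
  have := hG.1
  have := hG'.1
  have := hGs.1
  have hR0 : 0 < R := by linarith
  have htail := setLIntegral_laplaceMixture_le hS hdet hlam hd G
    ((mixingMeasures_ae_mem hG).mono fun θ hθ => hΘ θ hθ) R
  set a := Real.sqrt (2 / (lam * lambdaMax S)) with ha
  have ha0 : 0 ≤ a := Real.sqrt_nonneg _
  set N := Real.exp (8 / 9 * a * r) * (729 / 89 * (1 / 10 : ℝ) ^ (-((d : ℝ) / 2))) with hN
  have hN0 : 0 ≤ N := by positivity
  have hw : ∀ᵐ x : E, ‖x‖ ≤ R → 1 ≤ ENNReal.ofReal (C₁ * Real.exp (C₀ * R ^ α)) *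
      (mixtureDensity f₀ G₀ x / mixtureDensity (laplaceKernel S lam) Gs x) := by
    filter_upwards [mixtureDensity_laplaceKernel_ae_eq hd hS hlam Gs,
      laplaceMixture_ae_ne_top hS hdet hlam Gs] with x h1 h2 hx
    rw [← mul_div_assoc, ENNReal.le_div_iff_mul_le
      (Or.inl (by rw [h1]; exact laplaceMixture_ne_zero hlam Gs x)) (Or.inl (by rwa [h1])), one_mul]
    exact hT.mixtureDensity_le hC₁ hGs hR0 hx
  have hmain := lintegral_tsub_le_of_weight (s := Real.exp (-(a * R)))
    (measurable_laplaceMixture S lam G)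
    (measurable_laplaceMixture S lam G') (lintegral_laplaceMixture hS hdet hlam G)
    (lintegral_laplaceMixture hS hdet hlam G') ENNReal.ofReal_ne_top
    (Real.exp_pos _) hw
  rw [lintegral_eq_two_mul_weightedHellinger_sq (mixtureDensity_laplaceKernel_ae_eq hd hS hlam G)
    (mixtureDensity_laplaceKernel_ae_eq hd hS hlam G')] at hmain
  refine hmain.trans ?_
  have hexp : Real.exp (-(a * R)) ≤ Real.exp (-(8 / 9 * a * R)) := by
    refine Real.exp_le_exp.2 ?_
    have : 0 ≤ a * R := by positivity
    linarith
  have hRα : R ≤ R ^ α := by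
    simpa using Real.rpow_le_rpow_of_exponent_le hR hα
  have e1 : ENNReal.ofReal (Real.exp (-(a * R))) * 2 ≤
      ENNReal.ofReal (2 * Real.exp (-(8 / 9 * a * R))) := by
    rw [mul_comm, ENNReal.ofReal_mul (by norm_num)]
    gcongr
    simp
  have e2 : ENNReal.ofReal (1 / (2 * Real.exp (-(a * R)))) *
      (ENNReal.ofReal (C₁ * Real.exp (C₀ * R ^ α)) *
        (2 * weightedHellinger (mixtureDensity f₀ G₀) (mixtureDensity (laplaceKernel S lam) Gs)
      (mixtureDensity (laplaceKernel S lam) G) (mixtureDensity (laplaceKernel S lam) G') ^ 2)) ≤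
      ENNReal.ofReal (C₁ * Real.exp (-(8 / 9 * a * R))) := by
    calc _ ≤ ENNReal.ofReal (1 / (2 * Real.exp (-(a * R)))) *
          (ENNReal.ofReal (C₁ * Real.exp (C₀ * R ^ α)) *
          (ENNReal.ofReal 2 *
            ENNReal.ofReal (Real.exp (-((a + C₀ / 2) * R ^ α))) ^ 2)) := by
          gcongr
          simp
      _ = ENNReal.ofReal (C₁ * Real.exp (a * R - 2 * a * R ^ α)) := by
          rw [← ENNReal.ofReal_pow (Real.exp_pos _).le, ← ENNReal.ofReal_mul (by norm_num),
            ← ENNReal.ofReal_mul (by positivity), ← ENNReal.ofReal_mul (by positivity)]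
          congr 1
          have h3 : Real.exp (a * R - 2 * a * R ^ α) = (Real.exp (-(a * R)))⁻¹ *
              (Real.exp (C₀ * R ^ α) * Real.exp (-((a + C₀ / 2) * R ^ α)) ^ 2) := by
            rw [← Real.exp_neg, ← Real.exp_nat_mul, ← Real.exp_add, ← Real.exp_add]
            congr 1
            push_cast
            ring
          rw [h3]
          field_simp
      _ ≤ _ := by
          refine ENNReal.ofReal_le_ofReal (mul_le_mul_of_nonneg_left ?_ hC₁.le)
          refine le_trans (Real.exp_le_exp.2 ?_) hexp
          nlinarith [mul_le_mul_of_nonneg_left hRα ha0]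
  calc _ ≤ ENNReal.ofReal (2 * Real.exp (-(8 / 9 * a * R))) +
        ENNReal.ofReal (N * Real.exp (-(8 / 9 * a * R))) +
        ENNReal.ofReal (C₁ * Real.exp (-(8 / 9 * a * R))) := add_le_add (add_le_add e1 htail) e2
    _ = _ := by
      rw [← ENNReal.ofReal_add (by positivity) (by positivity),
        ← ENNReal.ofReal_add (by positivity) (by positivity)]
      congr 1
      ring

/-- The deconvolution bound at smoothing scale `η = exp (-4 a R / 9)`, the square root of the total
variation bound obtained by truncation at radius `R`. -/
theorem wasserstein_sq_toReal_le {R : ℝ} (hR : 1 ≤ R)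
    (hH : weightedHellinger (mixtureDensity f₀ G₀) (mixtureDensity (laplaceKernel S lam) Gs)
      (mixtureDensity (laplaceKernel S lam) G) (mixtureDensity (laplaceKernel S lam) G') ≤
      ENNReal.ofReal (Real.exp (-((Real.sqrt (2 / (lam * lambdaMax S)) + C₀ / 2) * R ^ α)))) :
    (wasserstein 2 G G').toReal ^ 2 ≤
      (16 * lambdaMax S * lam * (1 / 2) ^ (-((d : ℝ) / 2)) + 4 * (2 * r) ^ 2 *
        (2 + Real.exp (8 / 9 * Real.sqrt (2 / (lam * lambdaMax S)) * r) *
        (729 / 89 * (1 / 10) ^ (-((d : ℝ) / 2))) + C₁)) *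
        Real.exp (-(4 / 9 * (Real.sqrt (2 / (lam * lambdaMax S)) * R))) := by
  have := hG.1
  have := hG'.1
  have hl := lambdaMax_pos hd hS
  have hR0 : 0 < R := by linarith
  have hsym : weightedHellinger (mixtureDensity f₀ G₀) (mixtureDensity (laplaceKernel S lam) Gs)
      (mixtureDensity (laplaceKernel S lam) G') (mixtureDensity (laplaceKernel S lam) G) =
      weightedHellinger (mixtureDensity f₀ G₀) (mixtureDensity (laplaceKernel S lam) Gs)
      (mixtureDensity (laplaceKernel S lam) G) (mixtureDensity (laplaceKernel S lam) G') := by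
    unfold weightedHellinger
    simp only [sub_sq_comm (Real.sqrt (mixtureDensity (laplaceKernel S lam) G' _).toReal)]
  have hV := lintegral_tsub_laplaceMixture_le hS hdet hlam hd hΘ hC₁ hα hT hGs hG hG' hR hH
  have hV' := lintegral_tsub_laplaceMixture_le hS hdet hlam hd hΘ hC₁ hα hT hGs hG' hG hR
    (hsym.trans_le hH)
  set a := Real.sqrt (2 / (lam * lambdaMax S)) with ha
  have ha0 : 0 ≤ a := Real.sqrt_nonneg _
  set M := 2 + Real.exp (8 / 9 * a * r) * (729 / 89 * (1 / 10 : ℝ) ^ (-((d : ℝ) / 2))) + C₁ with hM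
  have hM0 : 0 < M := by positivity
  set η := Real.exp (-(4 / 9 * (a * R))) with hη
  have hη0 : 0 < η := Real.exp_pos _
  have hη1 : η ≤ 1 := by
    rw [hη, Real.exp_le_one_iff]
    have : 0 ≤ a * R := by positivity
    linarith
  have hη2 : Real.exp (-(8 / 9 * a * R)) = η * η := by
    rw [hη, ← Real.exp_add]; congr 1; ring
  rw [hη2] at hV hV'
  have hD : ∀ᵐ θ ∂G, ∀ᵐ θ' ∂G', ‖θ - θ'‖ ≤ 2 * r := by
    filter_upwards [mixingMeasures_ae_mem hG] with θ hθ
    filter_upwards [mixingMeasures_ae_mem hG'] with θ' hθ'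
    have := norm_sub_le θ θ'
    linarith [hΘ θ hθ, hΘ θ' hθ']
  have hW := wasserstein_sq_le_laplace hS hdet hlam hd hη0 G G' hD
  have hfin : wasserstein 2 G G' ^ 2 ≤ ENNReal.ofReal
      ((16 * lambdaMax S * lam * (1 / 2) ^ (-((d : ℝ) / 2)) + 4 * (2 * r) ^ 2 * M) * η) := by
    refine hW.trans ?_
    have hinv : (ENNReal.ofReal (1 - Real.exp (-η)))⁻¹ ≤ ENNReal.ofReal (2 / η) := by
      rw [← ENNReal.ofReal_inv_of_pos (one_sub_exp_neg_pos hη0)]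
      refine ENNReal.ofReal_le_ofReal ?_
      rw [show 2 / η = (η / 2)⁻¹ by rw [inv_div]]
      exact inv_anti₀ (by positivity) (half_le_one_sub_exp_neg hη0 hη1)
    calc _ ≤ ENNReal.ofReal 4 *
          ENNReal.ofReal (4 * lambdaMax S * (lam * η) * (1 / 2) ^ (-((d : ℝ) / 2))) +
          ENNReal.ofReal ((2 * r) ^ 2) * (ENNReal.ofReal (2 / η) *
            (ENNReal.ofReal (M * (η * η)) + ENNReal.ofReal (M * (η * η)))) := by
          gcongr
          simp
      _ = _ := by
          rw [← ENNReal.ofReal_add (by positivity) (by positivity),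
            ← ENNReal.ofReal_mul (by positivity), ← ENNReal.ofReal_mul (by positivity),
            ← ENNReal.ofReal_mul (by positivity),
            ← ENNReal.ofReal_add (by positivity) (by positivity)]
          congr 1
          field_simp
          ring
  rw [← ENNReal.toReal_pow]
  refine ENNReal.toReal_le_of_le_ofReal (by positivity) hfin

end

/-- The truncation radius is `R = (log (1/h) / (a + b + C₀)) ^ (1/α)`, for which `exp (-a R)` is the
exponential factor of the rate; the power of the logarithm is at least `1` once `h ≤ 1/e`. -/
theorem exp_neg_radius_le_laplaceRate {S : Matrix (Fin d) (Fin d) ℝ} {lam C₀ α h : ℝ}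
    (hC₀ : 0 < C₀) (hα : 1 ≤ α) (h0 : 0 < h) (h1 : h ≤ Real.exp (-1)) :
    ∃ R : ℝ, 0 ≤ R ∧
      h ≤ Real.exp (-((Real.sqrt (2 / (lam * lambdaMax S)) + C₀ / 2) * R ^ α)) ∧
      Real.exp (-(Real.sqrt (2 / (lam * lambdaMax S)) * R)) ≤ laplaceRate S lam C₀ α h := by
  set a := Real.sqrt (2 / (lam * lambdaMax S)) with ha
  have ha0 : 0 ≤ a := Real.sqrt_nonneg _
  set b := Real.sqrt (2 / (lam * lambdaMin S)) with hb
  have hb0 : 0 ≤ b := Real.sqrt_nonneg _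
  set L := Real.log (1 / h) with hL
  have hLh : L = -Real.log h := by rw [hL, one_div, Real.log_inv]
  have hL1 : 1 ≤ L := by
    rw [hLh]
    have := Real.log_le_log h0 h1
    rw [Real.log_exp] at this
    linarith
  have hB : 0 < b + a + C₀ := by positivity
  have hα0 : α ≠ 0 := by linarith
  refine ⟨(L / (b + a + C₀)) ^ (1 / α), by positivity, ?_, ?_⟩
  · rw [← Real.rpow_mul (by positivity), one_div_mul_cancel hα0, Real.rpow_one,
      ← Real.log_le_iff_le_exp h0, show Real.log h = -L by rw [hLh]; ring, neg_le_neg_iff,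
      ← mul_div_assoc, div_le_iff₀ hB]
    nlinarith
  · have hτ : tauExponent S lam C₀ α * L ^ (1 / α) = a * (L / (b + a + C₀)) ^ (1 / α) := by
      rw [tauExponent, Real.div_rpow (by positivity) hB.le, ← ha, ← hb]
      ring
    rw [laplaceRate, ← hL, neg_mul, hτ]
    exact le_mul_of_one_le_left (Real.exp_pos _).le (Real.one_le_rpow hL1 (by positivity))

end

theorem mainTheorem8 (d : ℕ) (hd : 1 ≤ d)
    (Θ : Set (EuclideanSpace ℝ (Fin d))) (hΘ : Bornology.IsBounded Θ)
    (S : Matrix (Fin d) (Fin d) ℝ) (hS : S.PosDef) (hdet : S.det = 1)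
    (lam : ℝ) (hlam : 0 < lam) :
    ∃ ε₀ : ℝ, 0 < ε₀ ∧ ε₀ < 1 ∧
      ∀ m : ℝ, 0 < m → m < 4 / (4 + 5 * (d : ℝ)) →
      ∀ G₀ : Measure (EuclideanSpace ℝ (Fin d)), IsProbabilityMeasure G₀ →
      ∀ C₁ : ℝ, 0 < C₁ →
      ∃ C : ℝ, 0 < C ∧
        ∀ C₀ : ℝ, 0 < C₀ → ∀ α : ℝ, 1 ≤ α →
        ∀ f₀ : EuclideanSpace ℝ (Fin d) → EuclideanSpace ℝ (Fin d) → ℝ≥0∞,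
        IsDensityKernel f₀ G₀.support →
        TailCondition Θ (laplaceKernel S lam) f₀ G₀ C₀ C₁ α →
        ∀ Gs : Measure (EuclideanSpace ℝ (Fin d)),
        IsKLMinimizer Θ (laplaceKernel S lam) (mixtureDensity f₀ G₀) Gs →
        ∀ G ∈ mixingMeasures Θ, ∀ G' ∈ mixingMeasures Θ,
          weightedHellinger (mixtureDensity f₀ G₀) (mixtureDensity (laplaceKernel S lam) Gs)
              (mixtureDensity (laplaceKernel S lam) G)
              (mixtureDensity (laplaceKernel S lam) G') ≤ ENNReal.ofReal ε₀ →
          laplaceRate S lam C₀ α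
              (weightedHellinger (mixtureDensity f₀ G₀)
                (mixtureDensity (laplaceKernel S lam) Gs)
                (mixtureDensity (laplaceKernel S lam) G)
                (mixtureDensity (laplaceKernel S lam) G')).toReal ≥
            C * (wasserstein 2 G G').toReal ^ (2 / m) := by
  obtain ⟨r, hr0, hr⟩ := hΘ.exists_pos_norm_le
  have hl := lambdaMax_pos hd hS
  refine ⟨Real.exp (-1), Real.exp_pos _, by simp, ?_⟩
  intro m hm hmd G₀ hG₀ C₁ hC₁
  set a := Real.sqrt (2 / (lam * lambdaMax S)) with ha
  have ha0 : 0 < a := Real.sqrt_pos.2 (by positivity)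
  set K := 16 * lambdaMax S * lam * (1 / 2) ^ (-((d : ℝ) / 2)) + 4 * (2 * r) ^ 2 *
        (2 + Real.exp (8 / 9 * a * r) * (729 / 89 * (1 / 10) ^ (-((d : ℝ) / 2))) + C₁) with hK
  have hK0 : 0 < K := by positivity
  -- the second summand covers the radii `R < 1`, where only `W₂ ≤ 2 r` is used
  set K' := K + (2 * r) ^ 2 * Real.exp (4 / 9 * a) with hK'
  have hK'0 : 0 < K' := by positivity
  -- the only place where the bound on `m` enters
  have hm9 : 1 ≤ 4 / 9 * (1 / m) := by
    have hd1 : (1 : ℝ) ≤ d := by exact_mod_cast hd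
    have h1 : 4 / (4 + 5 * (d : ℝ)) ≤ 4 / 9 := by
      gcongr; linarith
    rw [mul_one_div, le_div_iff₀ hm]
    linarith
  refine ⟨(K' ^ (1 / m))⁻¹, by positivity, ?_⟩
  intro C₀ hC₀ α hα f₀ _ hT Gs hKL G hG G' hG' hH
  have := hG.1
  have := hG'.1
  have hbound := fun {R : ℝ} => wasserstein_sq_toReal_le hS hdet hlam hd hr hC₁ hα hT hKL.1 hG hG'
    (R := R)
  set H := weightedHellinger (mixtureDensity f₀ G₀) (mixtureDensity (laplaceKernel S lam) Gs)
    (mixtureDensity (laplaceKernel S lam) G) (mixtureDensity (laplaceKernel S lam) G')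
  set w := (wasserstein 2 G G').toReal
  have hw0 : 0 ≤ w := ENNReal.toReal_nonneg
  have hHt : H ≠ ∞ := ne_top_of_le_ne_top ENNReal.ofReal_ne_top hH
  rcases eq_or_ne H 0 with hH0 | hH0
  · -- all truncation radii are admissible, so the distance vanishes
    have hlim : Tendsto (fun R : ℝ => K * Real.exp (-(4 / 9 * (a * R)))) atTop (𝓝 0) := by
      have h1 : Tendsto (fun R : ℝ => 4 / 9 * (a * R)) atTop atTop :=
        (tendsto_id.const_mul_atTop ha0).const_mul_atTop (by norm_num)
      simpa using (Real.tendsto_exp_neg_atTop_nhds_zero.comp h1).const_mul K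
    have hw2 : w ^ 2 ≤ 0 := by
      refine ge_of_tendsto hlim ?_
      filter_upwards [eventually_ge_atTop (1 : ℝ)] with R hR
      exact hbound hR (by rw [hH0]; simp)
    have hw : w = 0 := by nlinarith
    rw [hw, hH0, Real.zero_rpow (by positivity), mul_zero, ENNReal.toReal_zero,
      laplaceRate_zero hd S lam C₀ α hα]
  · have hh0 : 0 < H.toReal := ENNReal.toReal_pos hH0 hHt
    have hh1 : H.toReal ≤ Real.exp (-1) :=
      ENNReal.toReal_le_of_le_ofReal (Real.exp_pos _).le hH
    obtain ⟨R, hR0, hhR, hrate⟩ :=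
      exp_neg_radius_le_laplaceRate (S := S) (lam := lam) hC₀ hα hh0 hh1
    have hw2 : w ^ 2 ≤ K' * Real.exp (-(4 / 9 * (a * R))) := by
      rcases le_total 1 R with h1 | h1
      · have hHR := (ENNReal.le_ofReal_iff_toReal_le hHt (Real.exp_pos _).le).2 hhR
        refine (hbound h1 hHR).trans ?_
        gcongr
        rw [hK']
        linarith [show 0 < (2 * r) ^ 2 * Real.exp (4 / 9 * a) by positivity]
      · have hD : ∀ᵐ θ ∂G, ∀ᵐ θ' ∂G', ‖θ - θ'‖ ≤ 2 * r := by
          filter_upwards [mixingMeasures_ae_mem hG] with θ hθ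
          filter_upwards [mixingMeasures_ae_mem hG'] with θ' hθ'
          have := norm_sub_le θ θ'
          linarith [hr θ hθ, hr θ' hθ']
        have hwD : w ≤ 2 * r :=
          ENNReal.toReal_le_of_le_ofReal (by positivity) (wasserstein_two_le hD (by positivity))
        have hexp : 1 ≤ Real.exp (4 / 9 * a) * Real.exp (-(4 / 9 * (a * R))) := by
          rw [← Real.exp_add, Real.one_le_exp_iff]
          nlinarith
        calc w ^ 2 ≤ (2 * r) ^ 2 * 1 := by rw [mul_one]; gcongr
          _ ≤ (2 * r) ^ 2 * (Real.exp (4 / 9 * a) * Real.exp (-(4 / 9 * (a * R)))) := by gcongr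
          _ ≤ K' * Real.exp (-(4 / 9 * (a * R))) := by
              rw [← mul_assoc, hK']
              gcongr
              linarith
    have hwm : w ^ (2 / m) ≤ K' ^ (1 / m) * Real.exp (-(a * R)) := by
      calc w ^ (2 / m) = (w ^ 2) ^ (1 / m) := by
            rw [← Real.rpow_natCast, ← Real.rpow_mul hw0]; congr 1; push_cast; ring
        _ ≤ (K' * Real.exp (-(4 / 9 * (a * R)))) ^ (1 / m) := by gcongr
        _ = K' ^ (1 / m) * Real.exp (-(4 / 9 * (1 / m) * (a * R))) := by
            rw [Real.mul_rpow hK'0.le (Real.exp_pos _).le, ← Real.exp_mul]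
            congr 2
            ring
        _ ≤ K' ^ (1 / m) * Real.exp (-(a * R)) := by
            refine mul_le_mul_of_nonneg_left (Real.exp_le_exp.2 (neg_le_neg ?_)) (by positivity)
            exact le_mul_of_one_le_left (mul_nonneg ha0.le hR0) hm9
    calc (K' ^ (1 / m))⁻¹ * w ^ (2 / m)
        ≤ (K' ^ (1 / m))⁻¹ * (K' ^ (1 / m) * Real.exp (-(a * R))) := by gcongr
      _ = Real.exp (-(a * R)) := by
          rw [← mul_assoc, inv_mul_cancel₀ (Real.rpow_pos_of_pos hK'0 _).ne', one_mul]
      _ ≤ _ := hrate
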